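/- Let $\mu$ be a probability measure on a countable set $\Omega$ with $\mu(\{x\})>0$ for all $x\in\Omega$, and let $\mathcal E$ be a form with domain $\mathcal H\subset L_2(\Omega,\mu)$. Write $\mathrm{Ent}_\mu(f)=\int f\log f\,d\mu-\int f\,d\mu\,\log\int f\,d\mu$. For $p\in(0,1)$ and $C>0$, the pair $(\mu,\mathcal E)$ satisfies $p$-LS$(C)$ if $$\mathrm{Ent}_\mu(f^p)\le \frac{Cp^2}{4(p-1)}\,\mathcal E(f^{p-1},f)\qquad\text{for all } f\in\mathcal H,\ f>0,\ \text{with } f^{p-1}\in\mathcal H;$$ it satisfies $1$-LS$(C)$ if $\mathrm{Ent}_\mu(f)\le\frac C4\,\mathcal E(f,\log f)$ for all $f\in\mathcal H$, $f>0$, with $\log f\in\mathcal H$. It satisfies the $p$-log-Sobolev inequality if $p$-LS$(C)$ holds for some finite $C>0$. For a fully supported probability measure $\mu$ on $\mathbb N=\{0,1,2,\dots\}$, with $\mu_k=\mu(\{k\})$ and $Df(k)=f(k+1)-f(k)$, the birth–death Dirichlet form is $\mathcal E(f,g)=\sum_{k\ge0}Df(k)\,Dg(k)\,\mu_k$ with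 domain $\mathcal H=\{h\in L_2(\mu):\sum_k (Dh(k))^2\mu_k<\infty\}$. **Theorem.** (1) For every $p\in(0,1)$ there is a fully supported probability measure $\mu$ on $\mathbb N$, namely the Conway–Maxwell–Poisson law $\mu_k=\frac1Z (k!)^{-p}$ with $Z=\sum_{j\ge0}(j!)^{-p}$, which, with the birth–death Dirichlet form, does not satisfy the $p$-log-Sobolev inequality but satisfies the $q$-log-Sobolev inequality for every $q\in(0,p)$. (2) No set $I\subset(0,1]$ with non-empty interior (in particular, no non-degenerate interval) has the following property asked for by Mossel, Oleszkiewicz and Sen: there is a constant $c>0$, depending on $I$ only, such that for all $p,q\in I$ and all $C>0$, $p$-LS$(C)$ implies $q$-LS$(cC)$, for every countable set $\Omega$ with a fully supported probability measure $\mu$ and every homogeneous Markov transition function $P(t,x,dy)$ on $\Omega$ that is reversible with respect to $\mu$ and induces a strongly continuous semigroup on $L_2(\Omega,\mu)$, where $$\mathcal E(f,g)=\lim_{t\to0^+}\frac1{2t}\int_\Omega\int_\Omega (f(x)-f(y))(g(x)-g(y))\,P(t,x,dy)\,\mu(dx)$$ on the domain $\mathcal H$ of those $f\in L_2(\Omega,\mu)$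 for which $\sup_{t>0}\frac1{2t}\int_\Omega\int_\Omega (f(x)-f(y))^2\,P(t,x,dy)\,\mu(dx)<\infty$. -/

import Mathlib

open MeasureTheory ProbabilityTheory Filter Topology Set
open scoped NNReal ENNReal Nat

noncomputable section

/-- The entropy functional `Ent_μ(f) = ∫ f log f dμ - (∫ f dμ) log (∫ f dμ)`. -/
def Ent {Ω : Type*} [MeasurableSpace Ω] (μ : Measure Ω) (f : Ω → ℝ) : ℝ :=
  (∫ x, f x * Real.log (f x) ∂μ) - (∫ x, f x ∂μ) * Real.log (∫ x, f x ∂μ)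

/-- The `p`-log-Sobolev inequality with constant `C`, for a measure `μ` and a form `E` with
domain `H`. It is used for `p ∈ (0, 1]`. For `f` and `f ^ (p - 1)` (respectively `log f`) in
`H ⊆ L²(μ)`, the function `f ^ p log (f ^ p)` is integrable, so the entropy is a genuine one. -/
def LogSobolevWith {Ω : Type*} [MeasurableSpace Ω] (μ : Measure Ω)
    (H : Set (Ω → ℝ)) (E : (Ω → ℝ) → (Ω → ℝ) → ℝ) (p C : ℝ) : Prop :=
  if p = 1 then
    ∀ f : Ω → ℝ, f ∈ H → (∀ x, 0 < f x) → (fun x => Real.log (f x)) ∈ H →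
      Ent μ f ≤ C / 4 * E f (fun x => Real.log (f x))
  else
    ∀ f : Ω → ℝ, f ∈ H → (∀ x, 0 < f x) → (fun x => f x ^ (p - 1)) ∈ H →
      Ent μ (fun x => f x ^ p) ≤ C * p ^ 2 / (4 * (p - 1)) * E (fun x => f x ^ (p - 1)) f

/-- The domain of the birth-death form on `ℕ`: functions `h ∈ L²(μ)` with
`∑ₖ (h (k + 1) - h k)² μ_k < ∞`. -/
def birthDeathDomain (μ : Measure ℕ) : Set (ℕ → ℝ) :=
  {h | MemLp h 2 μ ∧ Summable fun k => (h (k + 1) - h k) ^ 2 * μ.real {k}}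

/-- The birth-death form on `ℕ`: `E(f, g) = ∑ₖ (f (k + 1) - f k) (g (k + 1) - g k) μ_k`.
The series converges absolutely for `f, g` in `birthDeathDomain μ`. -/
def birthDeathForm (μ : Measure ℕ) (f g : ℕ → ℝ) : ℝ :=
  ∑' k, (f (k + 1) - f k) * (g (k + 1) - g k) * μ.real {k}

/-- The measure `μ` on `ℕ`, with the birth-death Dirichlet form, satisfies the `p`-log-Sobolev
inequality with some finite constant. -/
def BirthDeathLogSobolev (μ : Measure ℕ) (p : ℝ) : Prop :=
  ∃ C : ℝ, 0 < C ∧ LogSobolevWith μ (birthDeathDomain μ) (birthDeathForm μ) p C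

/-- `P` is a homogeneous Markov transition function, reversible with respect to `μ` (so that `μ`
is invariant), whose semigroup `P_t f (x) = ∫ f(y) P(t, x, dy)` is strongly continuous
on `L²(μ)`. -/
structure IsReversibleMarkovSemigroup {Ω : Type*} [MeasurableSpace Ω] (μ : Measure Ω)
    (P : ℝ≥0 → Kernel Ω Ω) : Prop where
  markov : ∀ t, IsMarkovKernel (P t)
  zero : P 0 = Kernel.id
  add : ∀ s t, P (s + t) = (P t) ∘ₖ (P s)
  reversible : ∀ t, (P t).IsReversible μ
  continuous : ∀ f : Ω → ℝ, MemLp f 2 μ →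
    Tendsto (fun t : ℝ≥0 => eLpNorm (fun x => (∫ y, f y ∂(P t x)) - f x) 2 μ) (𝓝[>] 0) (𝓝 0)

/-- The domain of the Dirichlet form of the semigroup: functions `f ∈ L²(μ)` with
`sup_{t > 0} (1 / 2t) ∫∫ (f x - f y)² P(t, x, dy) μ(dx) < ∞`. -/
def semigroupDomain {Ω : Type*} [MeasurableSpace Ω] (μ : Measure Ω)
    (P : ℝ≥0 → Kernel Ω Ω) : Set (Ω → ℝ) :=
  {f | MemLp f 2 μ ∧
    (⨆ (t : ℝ≥0) (_ : 0 < t),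
      (∫⁻ x, ∫⁻ y, ENNReal.ofReal ((f x - f y) ^ 2) ∂(P t x) ∂μ) / (2 * (t : ℝ≥0∞))) < ∞}

/-- The Dirichlet form of the semigroup,
`E(f, g) = lim_{t → 0⁺} (1 / 2t) ∫∫ (f x - f y) (g x - g y) P(t, x, dy) μ(dx)`. The limit exists
for `f, g` in `semigroupDomain μ P`. -/
def semigroupForm {Ω : Type*} [MeasurableSpace Ω] (μ : Measure Ω)
    (P : ℝ≥0 → Kernel Ω Ω) (f g : Ω → ℝ) : ℝ :=
  limUnder (𝓝[>] (0 : ℝ≥0)) fun t : ℝ≥0 =>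
    (1 / (2 * (t : ℝ))) * ∫ x, ∫ y, (f x - f y) * (g x - g y) ∂(P t x) ∂μ

/-- The equivalence property of Mossel, Oleszkiewicz and Sen for a set `I` of exponents: there is
a constant `c > 0` such that for all `p, q ∈ I`, on every discrete probability space with a fully
supported measure and a reversible Markov semigroup, and for every `C > 0`, the `p`-log-Sobolev
inequality with constant `C` implies the `q`-log-Sobolev inequality with constant `c * C`. -/
def MOSEquivalence (I : Set ℝ) : Prop :=
  ∃ c : ℝ, 0 < c ∧ ∀ p ∈ I, ∀ q ∈ I,
    ∀ (Ω : Type) [Countable Ω] [MeasurableSpace Ω] [MeasurableSingletonClass Ω]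
      (μ : Measure Ω) [IsProbabilityMeasure μ] (P : ℝ≥0 → Kernel Ω Ω),
      (∀ x, 0 < μ {x}) → IsReversibleMarkovSemigroup μ P → ∀ C : ℝ, 0 < C →
        LogSobolevWith μ (semigroupDomain μ P) (semigroupForm μ P) p C →
        LogSobolevWith μ (semigroupDomain μ P) (semigroupForm μ P) q (c * C)

end

/-! Put g = f ^ q and s = 1 / q. The `q`-log-Sobolev inequality becomes Ent(g) ≤ C ∑ μ_k Φ(g_k,
g_{k+1}), where Φ = `pairEnergy s` is nonnegative for s > 1 and homogeneous of degree one. Write w_k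
= (k!)⁻ᵖ.

Failure at `p`: take f(k) = k!, frozen from `n` on. Then w_k f(k)^p = 1 for k ≤ n, and each edge k <
n contributes at most k to the energy, so the energy and the subtracted mean term of the entropy are
O(n²). The main entropy term is at least p ∑_{k ≤ n} log k!, which outgrows every quadratic
(`exists_quadratic_lt_sum_log_factorial`).

Validity for q < p: Ent(g) ≤ c ∑ w_k klFun(g_k / c) for every c > 0. The mass beyond k is at most a
constant times w_k / (k + 1)^p, so by summation by parts (`cmpWeight_hardy`) it suffices that each
increment of klFun is at most (k + 1)^p (ε klFun + K Φ) with ε small. Taking c at least the energy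
normalizes the energy to at most 1, which forces log g_k = O(k log k). Since p s > 1, this is O(m^s)
with m = (k + 1)^p. Consider now a jump from a to a(1 + t) (`klFun_increment_le`). If t is small
compared with ε m, the term m ε klFun(a) pays for it. Otherwise m is at most a multiple of t, so log
a ≤ B m^s is at most a multiple of m t^(s-1), and Φ, which is of order a (1 + t)^s, pays.

These bounds are proved on {0, …, N} with a constant independent of N. Letting N tend to infinity
gives the positive half of (1). Keeping N finite gives reversible finite chains with a uniform
`q`-constant and unbounded `p`-constants, which refutes the equivalence in (2). -/

/-! ### Estimates for the energy of one edge. -/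

/-- The energy of the pair `(a, b)` of values of `f ^ (1 / s)`, that is
`-(D f) (D f ^ (1 / s - 1))` written in terms of `f ^ (1 / s)`. -/
noncomputable def pairEnergy (s a b : ℝ) : ℝ := (b ^ s - a ^ s) * (a ^ (1 - s) - b ^ (1 - s))

theorem pairEnergy_comm (s a b : ℝ) : pairEnergy s a b = pairEnergy s b a := by
  unfold pairEnergy; ring

theorem pairEnergy_nonneg_of_le {s a b : ℝ} (hs : 1 < s) (ha : 0 < a) (hab : a ≤ b) :
    0 ≤ pairEnergy s a b :=
  mul_nonneg (sub_nonneg.2 (Real.rpow_le_rpow ha.le hab (by linarith)))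
    (sub_nonneg.2 (Real.rpow_le_rpow_of_nonpos ha hab (by linarith)))

theorem pairEnergy_nonneg {s a b : ℝ} (hs : 1 < s) (ha : 0 < a) (hb : 0 < b) :
    0 ≤ pairEnergy s a b := by
  rcases le_total a b with h | h
  · exact pairEnergy_nonneg_of_le hs ha h
  · rw [pairEnergy_comm]; exact pairEnergy_nonneg_of_le hs hb h

theorem pairEnergy_smul {s a b c : ℝ} (ha : 0 ≤ a) (hb : 0 ≤ b) (hc : 0 < c) :
    pairEnergy s (c * a) (c * b) = c * pairEnergy s a b := by
  have h : c ^ s * c ^ (1 - s) = c := by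
    rw [← Real.rpow_add hc]; simp
  unfold pairEnergy
  rw [Real.mul_rpow hc.le ha, Real.mul_rpow hc.le hb, Real.mul_rpow hc.le ha,
    Real.mul_rpow hc.le hb]
  linear_combination ((b ^ s - a ^ s) * (a ^ (1 - s) - b ^ (1 - s))) * h

/-- Both factors are differences of monotone functions across the interval, so they shrink with it.
Hence truncating a function from above or below does not increase its energy. -/
theorem pairEnergy_mono {s a b a' b' : ℝ} (hs : 1 < s) (ha : 0 < a) (haa : a ≤ a')
    (hab : a' ≤ b') (hbb : b' ≤ b) : pairEnergy s a' b' ≤ pairEnergy s a b := by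
  have ha' : 0 < a' := ha.trans_le haa
  have hb' : 0 < b' := ha'.trans_le hab
  have h1 := Real.rpow_le_rpow ha.le haa (z := s) (by linarith)
  have h2 := Real.rpow_le_rpow ha'.le hab (z := s) (by linarith)
  have h3 := Real.rpow_le_rpow hb'.le hbb (z := s) (by linarith)
  have h4 := Real.rpow_le_rpow_of_nonpos ha haa (z := 1 - s) (by linarith)
  have h5 := Real.rpow_le_rpow_of_nonpos ha' hab (z := 1 - s) (by linarith)
  have h6 := Real.rpow_le_rpow_of_nonpos hb' hbb (z := 1 - s) (by linarith)
  unfold pairEnergy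
  apply mul_le_mul <;> linarith

theorem pairEnergy_max_le {s a b : ℝ} (c : ℝ) (hs : 1 < s) (ha : 0 < a) (hb : 0 < b) :
    pairEnergy s (max a c) (max b c) ≤ pairEnergy s a b := by
  wlog hab : a ≤ b generalizing a b
  · rw [pairEnergy_comm, pairEnergy_comm s a]; exact this hb ha (le_of_not_ge hab)
  rcases le_total c b with h | h
  · exact pairEnergy_mono hs ha (le_max_left _ _) (max_le_max_right c hab) (max_le le_rfl h)
  · rw [max_eq_right h, max_eq_right (hab.trans h)]
    simpa [pairEnergy] using pairEnergy_nonneg_of_le hs ha hab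

theorem pairEnergy_min_le {s a b c : ℝ} (hs : 1 < s) (ha : 0 < a) (hb : 0 < b) :
    pairEnergy s (min a c) (min b c) ≤ pairEnergy s a b := by
  wlog hab : a ≤ b generalizing a b
  · rw [pairEnergy_comm, pairEnergy_comm s a]; exact this hb ha (le_of_not_ge hab)
  rcases le_total a c with h | h
  · exact pairEnergy_mono hs ha (le_min le_rfl h) (min_le_min_right c hab) (min_le_left _ _)
  · rw [min_eq_right h, min_eq_right (h.trans hab)]
    simpa [pairEnergy] using pairEnergy_nonneg_of_le hs ha hab

/-- `x ^ r ≤ 1 - min 1 r * (1 - x)` for `x ∈ [0, 1]`. -/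
theorem mul_one_sub_le_one_sub_rpow {x r : ℝ} (hx : 0 < x) (hx1 : x ≤ 1) (hr : 0 < r) :
    min 1 r * (1 - x) ≤ 1 - x ^ r := by
  rcases le_total r 1 with h | h
  · have := rpow_one_add_le_one_add_mul_self (s := x - 1) (by linarith) hr.le h
    rw [min_eq_right h]
    rw [show 1 + (x - 1) = x by ring] at this
    linarith
  · have := Real.rpow_le_rpow_of_exponent_ge hx hx1 h
    rw [Real.rpow_one] at this
    rw [min_eq_left h]; linarith

/-- With x = a / b the energy is exactly b^s a^(1-s) (1 - x^s)(1 - x^(s-1)). Each of the last two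
factors is compared with 1 - x; the exponent s - 1 may be below 1, whence the constant. -/
theorem le_pairEnergy {s a b : ℝ} (hs : 1 < s) (ha : 0 < a) (hab : a ≤ b) :
    min 1 (s - 1) * (a * (b / a) ^ s * (1 - a / b) ^ 2) ≤ pairEnergy s a b := by
  have hb : 0 < b := ha.trans_le hab
  have hx : 0 < a / b := by positivity
  have hx1 : a / b ≤ 1 := (div_le_one hb).2 hab
  have h1 := mul_one_sub_le_one_sub_rpow hx hx1 (r := s) (by linarith)
  rw [min_eq_left hs.le, one_mul] at h1
  have h2 := mul_one_sub_le_one_sub_rpow hx hx1 (r := s - 1) (by linarith)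
  have hm : 0 < min 1 (s - 1) := lt_min one_pos (by linarith)
  have e1 : b ^ s - a ^ s = b ^ s * (1 - (a / b) ^ s) := by
    rw [Real.div_rpow ha.le hb.le]; field_simp
  have e2 : a ^ (1 - s) - b ^ (1 - s) = a ^ (1 - s) * (1 - (a / b) ^ (s - 1)) := by
    rw [Real.div_rpow ha.le hb.le, show (1 - s) = -(s - 1) by ring, Real.rpow_neg ha.le,
      Real.rpow_neg hb.le]
    field_simp
  have e3 : a * (b / a) ^ s = b ^ s * a ^ (1 - s) := by
    rw [Real.div_rpow hb.le ha.le, Real.rpow_sub ha, Real.rpow_one]; ring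
  unfold pairEnergy
  rw [e1, e2, e3]
  have h0 : 0 ≤ 1 - a / b := by linarith
  have : (1 - a / b) * (min 1 (s - 1) * (1 - a / b)) ≤
      (1 - (a / b) ^ s) * (1 - (a / b) ^ (s - 1)) :=
    mul_le_mul h1 h2 (by positivity) (h0.trans h1)
  have h3 : 0 ≤ b ^ s * a ^ (1 - s) := by positivity
  nlinarith [mul_le_mul_of_nonneg_left this h3]

theorem sq_sub_le_pairEnergy {s a b : ℝ} (hs : 1 < s) (ha : 0 < a) (hb : 0 < b) (ha1 : a ≤ 1)
    (hb1 : b ≤ 1) : min 1 (s - 1) * (b - a) ^ 2 ≤ pairEnergy s a b := by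
  wlog hab : a ≤ b generalizing a b
  · rw [pairEnergy_comm, show (b - a) ^ 2 = (a - b) ^ 2 by ring]
    exact this hb ha hb1 ha1 (le_of_not_ge hab)
  refine le_trans ?_ (le_pairEnergy hs ha hab)
  have hm : 0 < min 1 (s - 1) := lt_min one_pos (by linarith)
  refine mul_le_mul_of_nonneg_left ?_ hm.le
  have h1 : b / a ≤ (b / a) ^ s := Real.self_le_rpow_of_one_le ((one_le_div ha).2 hab) hs.le
  calc (b - a) ^ 2 ≤ (b - a) ^ 2 / b := by
        rw [le_div_iff₀ hb]; nlinarith [sq_nonneg (b - a)]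
    _ = a * (b / a) * (1 - a / b) ^ 2 := by field_simp
    _ ≤ _ := by gcongr

/-! ### Growth of `klFun` along an edge. -/

open InformationTheory in
-- With L = log a, klFun(a) = a (e^(-L) - 1 + L), and e^(-L) ≥ (1 - L/2)² follows by squaring
-- e^(-L/2) ≥ 1 - L/2, which is nonnegative because L ≤ 2.
theorem sq_log_le_klFun {a : ℝ} (ha : 1 ≤ a) (h : Real.log a ≤ 2) :
    a * Real.log a ^ 2 / 4 ≤ klFun a := by
  have h0 : 0 < a := by linarith
  set L := Real.log a with hL
  have e : a * Real.exp (-L) = 1 := by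
    rw [Real.exp_neg, hL, Real.exp_log h0]; field_simp
  have h1 : (1 - L / 2) ^ 2 ≤ Real.exp (-L) := by
    have : Real.exp (-L) = Real.exp (-L / 2) ^ 2 := by rw [← Real.exp_nat_mul]; congr 1; ring
    rw [this]
    exact pow_le_pow_left₀ (by linarith) (by have := Real.add_one_le_exp (-L / 2); linarith) 2
  have := mul_le_mul_of_nonneg_left h1 h0.le
  rw [klFun_apply, ← hL]
  nlinarith

open InformationTheory in
theorem log_le_klFun {a : ℝ} (ha : 1 ≤ a) (h : 1 ≤ Real.log a) :
    a * Real.log a / 4 ≤ klFun a := by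
  rcases le_total (Real.log a) 2 with h2 | h2
  · refine le_trans ?_ (sq_log_le_klFun ha h2)
    have : 0 ≤ a * Real.log a * (Real.log a - 1) := by
      apply mul_nonneg <;> nlinarith
    nlinarith
  · rw [klFun_apply]; nlinarith

open InformationTheory in
-- The tangent-line inequality at b for the convex function `klFun`, whose derivative is the
-- logarithm.
theorem klFun_sub_le {a b : ℝ} (ha : 0 < a) (hb : 0 < b) :
    klFun b - klFun a ≤ (b - a) * Real.log b := by
  have : Real.log (b / a) ≤ b / a - 1 := Real.log_le_sub_one_of_pos (by positivity)
  rw [Real.log_div hb.ne' ha.ne'] at this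
  have h2 := mul_le_mul_of_nonneg_left this ha.le
  rw [mul_sub a (b / a), mul_div_cancel₀ b ha.ne'] at h2
  rw [klFun_apply, klFun_apply]; nlinarith

set_option maxHeartbeats 800000 in
/-- The growth of `klFun` along an edge is controlled by the energy of the edge and a small
multiple of the value of `klFun`, as long as the value is not too large. -/
theorem klFun_increment_le {s B ε : ℝ} (hs : 1 < s) (hB : 0 ≤ B) (hε : 0 < ε) (hε1 : ε ≤ 1) :
    ∃ K : ℝ, 0 ≤ K ∧ ∀ m a b : ℝ, 1 ≤ m → 1 ≤ a → 1 ≤ b → Real.log a ≤ B * m ^ s →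
      InformationTheory.klFun b - InformationTheory.klFun a ≤
        m * (ε * InformationTheory.klFun a + K * pairEnergy s a b) := by
  set κ := min 1 (s - 1) with hκ
  have hκ0 : 0 < κ := lt_min one_pos (by linarith)
  have hs1 : 0 < s - 1 := by linarith
  -- the part of the increment coming from `log (b / a)`
  set K₁ := 2 / κ + 4 / (κ * (s - 1)) with hK₁
  set K₂ := 2 / (κ * ε) + 4 / κ + B * (4 / ε) ^ (s - 1) * 64 / (κ * ε ^ 2) with hK₂
  have hK₁0 : 0 ≤ K₁ := by positivity
  have hK₂0 : 0 ≤ K₂ := by positivity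
  refine ⟨K₁ + K₂, by positivity, fun m a b hm ha hb hL => ?_⟩
  have ha0 : 0 < a := by linarith
  have hb0 : 0 < b := by linarith
  have hψ : 0 ≤ InformationTheory.klFun a := InformationTheory.klFun_nonneg ha0.le
  have hΦ := pairEnergy_nonneg hs ha0 hb0
  have hm0 : 0 < m := by linarith
  rcases le_total b a with hba | hab
  · have h1 : InformationTheory.klFun b - InformationTheory.klFun a ≤ 0 :=
      (klFun_sub_le ha0 hb0).trans
        (mul_nonpos_of_nonpos_of_nonneg (by linarith) (Real.log_nonneg hb))
    have : 0 ≤ m * (ε * InformationTheory.klFun a + (K₁ + K₂) * pairEnergy s a b) := by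
      positivity
    linarith
  obtain ⟨t, ht⟩ : ∃ t, b = a * (1 + t) := ⟨b / a - 1, by field_simp; ring⟩
  have ht0 : 0 ≤ t := by
    by_contra! h
    linarith only [ht, hab, mul_neg_of_pos_of_neg ha0 h]
  have hF := le_pairEnergy hs ha0 hab
  rw [← hκ] at hF
  have hR : b / a = 1 + t := by rw [ht]; field_simp
  have hR' : 1 - a / b = t / (1 + t) := by rw [ht]; field_simp; ring
  rw [hR, hR'] at hF
  set E := pairEnergy s a b with hE
  set L := Real.log a with hLdef
  have hL0 : 0 ≤ L := Real.log_nonneg ha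
  have hlogb : Real.log b = L + Real.log (1 + t) := by
    rw [ht, Real.log_mul ha0.ne' (by linarith)]
  have hRs : 1 + t ≤ (1 + t) ^ s := Real.self_le_rpow_of_one_le (by linarith) hs.le
  have hts : t ≤ (1 + t) ^ s := by linarith
  have hsmall : t ≤ 1 → a * t ^ 2 ≤ 2 / κ * E := by
    intro h
    have h1 : κ * (a * (1 + t) * (t / (1 + t)) ^ 2) ≤ E := by
      refine le_trans ?_ hF; gcongr
    have h2 : a * (1 + t) * (t / (1 + t)) ^ 2 = a * t ^ 2 / (1 + t) := by field_simp
    have h3 : a * t ^ 2 / 2 ≤ a * t ^ 2 / (1 + t) := by gcongr; linarith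
    rw [h2] at h1
    have : κ * (a * t ^ 2 / 2) ≤ E := (mul_le_mul_of_nonneg_left h3 hκ0.le).trans h1
    rw [div_mul_eq_mul_div, le_div_iff₀ hκ0]; linarith
  have hbig : 1 ≤ t → a * (1 + t) ^ s ≤ 4 / κ * E := by
    intro h
    have h1 : 1 / 2 ≤ t / (1 + t) := by rw [div_le_div_iff₀] <;> linarith
    have h2 : κ * (a * (1 + t) ^ s * (1 / 2) ^ 2) ≤ E := by
      refine le_trans ?_ hF; gcongr
    rw [div_mul_eq_mul_div, le_div_iff₀ hκ0]; linarith
  -- The increment is at most a t log b = a t log(1 + t) + a t L. The first summand needs only the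
  -- energy: log(1 + t) is at most t for small t and at most (1 + t)^(s-1) / (s - 1) for large t.
  have hA : a * t * Real.log (1 + t) ≤ K₁ * E := by
    rcases le_total t 1 with h | h
    · have h1 : Real.log (1 + t) ≤ t := by
        have := Real.log_le_sub_one_of_pos (show 0 < 1 + t by linarith); linarith
      calc a * t * Real.log (1 + t) ≤ a * t * t := by gcongr
        _ = a * t ^ 2 := by ring
        _ ≤ 2 / κ * E := hsmall h
        _ ≤ K₁ * E := by
          apply mul_le_mul_of_nonneg_right _ hΦ
          rw [hK₁]; have : 0 ≤ 4 / (κ * (s - 1)) := by positivity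
          linarith
    · have h1 := Real.log_le_rpow_div (show 0 ≤ 1 + t by linarith) hs1
      have h2 : (1 + t) ^ (s - 1) * (1 + t) = (1 + t) ^ s := by
        rw [← Real.rpow_add_one (by linarith)]; congr 1; ring
      calc a * t * Real.log (1 + t) ≤ a * (1 + t) * ((1 + t) ^ (s - 1) / (s - 1)) := by
            gcongr
            · exact Real.log_nonneg (by linarith)
            · linarith
        _ = a * (1 + t) ^ s / (s - 1) := by rw [← h2]; ring
        _ ≤ 4 / κ * E / (s - 1) := div_le_div_of_nonneg_right (hbig h) hs1.le
        _ = 4 / (κ * (s - 1)) * E := by field_simp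
        _ ≤ K₁ * E := by
          apply mul_le_mul_of_nonneg_right _ hΦ
          rw [hK₁]; have : 0 ≤ 2 / κ := by positivity
          linarith
  have hk1 : 2 / (κ * ε) ≤ K₂ := by
    have h1 : 0 ≤ 4 / κ := by positivity
    have h2 : 0 ≤ B * (4 / ε) ^ (s - 1) * 64 / (κ * ε ^ 2) := by positivity
    linarith
  have hk2 : 4 / κ ≤ K₂ := by
    have h1 : 0 ≤ 2 / (κ * ε) := by positivity
    have h2 : 0 ≤ B * (4 / ε) ^ (s - 1) * 64 / (κ * ε ^ 2) := by positivity
    linarith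
  have hk3 : B * (4 / ε) ^ (s - 1) * 64 / (κ * ε ^ 2) ≤ K₂ := by
    have h1 : 0 ≤ 2 / (κ * ε) := by positivity
    have h2 : 0 ≤ 4 / κ := by positivity
    linarith
  -- The summand a t L is the only one that needs the factor m and the bound on log a.
  have hC : a * t * L ≤ m * (ε * InformationTheory.klFun a + K₂ * E) := by
    have hpos : 0 ≤ ε * InformationTheory.klFun a + K₂ * E := by positivity
    have hψ' : 0 ≤ ε * InformationTheory.klFun a := by positivity
    have hm' : ∀ x, x ≤ ε * InformationTheory.klFun a + K₂ * E →
        x ≤ m * (ε * InformationTheory.klFun a + K₂ * E) := fun x hx =>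
      hx.trans (le_mul_of_one_le_left hpos hm)
    rcases le_total L 1 with hL1 | hL1
    · apply hm'
      rcases le_total t 1 with h | h
      -- Young's inequality, weighted so that the L² part is exactly ε times the lower bound for
      -- `klFun`.
      · have h1 : t * L ≤ ε * L ^ 2 / 4 + t ^ 2 / ε := by
          have : 0 ≤ (ε * L / 2 - t) ^ 2 / ε := by positivity
          have e : (ε * L / 2 - t) ^ 2 / ε = ε * L ^ 2 / 4 + t ^ 2 / ε - t * L := by
            field_simp; ring
          linarith
        have h2 := sq_log_le_klFun ha (by rw [← hLdef]; linarith)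
        rw [← hLdef] at h2
        have h3 := hsmall h
        calc a * t * L = a * (t * L) := by ring
          _ ≤ a * (ε * L ^ 2 / 4 + t ^ 2 / ε) := by gcongr
          _ = ε * (a * L ^ 2 / 4) + (a * t ^ 2) / ε := by ring
          _ ≤ ε * InformationTheory.klFun a + (2 / κ * E) / ε := by gcongr
          _ = ε * InformationTheory.klFun a + 2 / (κ * ε) * E := by
            congr 1; field_simp
          _ ≤ _ := by gcongr
      · calc a * t * L ≤ a * t * 1 := by gcongr
          _ ≤ a * (1 + t) ^ s := by rw [mul_one]; gcongr
          _ ≤ 4 / κ * E := hbig h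
          _ ≤ K₂ * E := by gcongr
          _ ≤ _ := by linarith
    · have h2 := log_le_klFun ha hL1
      rw [← hLdef] at h2
      rcases le_total t (ε * m / 4) with h | h
      · calc a * t * L ≤ a * (ε * m / 4) * L := by gcongr
          _ = m * (ε * (a * L / 4)) := by ring
          _ ≤ m * (ε * InformationTheory.klFun a) := by gcongr
          _ ≤ _ := by gcongr; linarith [mul_nonneg hK₂0 hΦ]
      -- A large jump: one factor m of m^s is kept, and the remaining m^(s-1) is traded for t^(s-1),
      -- which the energy controls.
      · have hmt : m ≤ 4 / ε * t := by
          rw [div_mul_eq_mul_div, le_div_iff₀ hε]; linarith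
        have ht' : ε / 4 ≤ t := by linarith only [h, le_mul_of_one_le_right hε.le hm]
        have ht8 : ε / 8 ≤ t / (1 + t) := by
          rw [div_le_div_iff₀ (by norm_num) (by linarith)]
          linarith only [ht0, ht', mul_le_mul_of_nonneg_right hε1 ht0]
        have h3 : a * (1 + t) ^ s ≤ 64 / (κ * ε ^ 2) * E := by
          have : κ * (a * (1 + t) ^ s * (ε / 8) ^ 2) ≤ E := by
            refine le_trans ?_ hF; gcongr
          rw [div_mul_eq_mul_div, le_div_iff₀ (by positivity)]; linarith
        have e1 : m ^ s = m * m ^ (s - 1) := by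
          rw [mul_comm, ← Real.rpow_add_one (by linarith)]; congr 1; ring
        have e2 : t * t ^ (s - 1) ≤ (1 + t) ^ s := by
          have : t * t ^ (s - 1) = t ^ s := by
            rw [mul_comm, ← Real.rpow_add_one (by linarith)]; congr 1; ring
          rw [this]; exact Real.rpow_le_rpow ht0 (by linarith) (by linarith)
        calc a * t * L ≤ a * t * (B * m ^ s) := by gcongr
          _ = m * (B * a * t * m ^ (s - 1)) := by rw [e1]; ring
          _ ≤ m * (B * a * t * (4 / ε * t) ^ (s - 1)) := by gcongr
          _ = m * (B * (4 / ε) ^ (s - 1) * (a * (t * t ^ (s - 1)))) := by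
            rw [Real.mul_rpow (by positivity) ht0]; ring
          _ ≤ m * (B * (4 / ε) ^ (s - 1) * (a * (1 + t) ^ s)) := by gcongr
          _ ≤ m * (B * (4 / ε) ^ (s - 1) * (64 / (κ * ε ^ 2) * E)) := by gcongr
          _ = m * (B * (4 / ε) ^ (s - 1) * 64 / (κ * ε ^ 2) * E) := by ring
          _ ≤ m * (K₂ * E) := by gcongr
          _ ≤ _ := by gcongr; linarith
  have hAm : a * t * Real.log (1 + t) ≤ m * (K₁ * E) :=
    hA.trans (le_mul_of_one_le_left (by positivity) hm)
  calc InformationTheory.klFun b - InformationTheory.klFun a ≤ (b - a) * Real.log b :=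
        klFun_sub_le ha0 hb0
    _ = a * t * L + a * t * Real.log (1 + t) := by rw [hlogb, ht]; ring
    _ ≤ m * (ε * InformationTheory.klFun a + K₂ * E) + m * (K₁ * E) := add_le_add hC hAm
    _ = _ := by ring

/-! ### The weights (k!)⁻ᵖ and their Hardy inequality. -/

/-- The unnormalized Conway–Maxwell–Poisson weight `(k!)⁻ᵖ`. -/
noncomputable def cmpWeight (p : ℝ) (k : ℕ) : ℝ := ((k ! : ℕ) : ℝ) ^ (-p)

theorem cmpWeight_pos (p : ℝ) (k : ℕ) : 0 < cmpWeight p k :=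
  Real.rpow_pos_of_pos (by exact_mod_cast k.factorial_pos) _

theorem cmpWeight_zero (p : ℝ) : cmpWeight p 0 = 1 := by simp [cmpWeight]

theorem cmpWeight_succ (p : ℝ) (k : ℕ) :
    cmpWeight p (k + 1) = cmpWeight p k * ((k : ℝ) + 1) ^ (-p) := by
  rw [cmpWeight, cmpWeight, Nat.factorial_succ, Nat.cast_mul,
    Real.mul_rpow (by positivity) (by positivity), mul_comm]
  push_cast; rfl

theorem cmpWeight_succ_le {p : ℝ} (hp : 0 < p) (k : ℕ) :
    cmpWeight p (k + 1) ≤ cmpWeight p k := by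
  rw [cmpWeight_succ]
  refine mul_le_of_le_one_right (cmpWeight_pos p k).le ?_
  exact Real.rpow_le_one_of_one_le_of_nonpos (by linarith [k.cast_nonneg (α := ℝ)]) (by linarith)

/-- Submultiplicativity, from k! i! ∣ (k + i)!. It bounds every tail by its first weight times the
total mass. -/
theorem cmpWeight_add_le {p : ℝ} (hp : 0 < p) (k i : ℕ) :
    cmpWeight p (k + i) ≤ cmpWeight p k * cmpWeight p i := by
  unfold cmpWeight
  rw [← Real.mul_rpow (by positivity) (by positivity)]
  refine Real.rpow_le_rpow_of_nonpos (by positivity) ?_ (by linarith)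
  exact_mod_cast Nat.le_of_dvd (Nat.factorial_pos _) (Nat.factorial_mul_factorial_dvd_factorial_add k i)

theorem summable_cmpWeight {p : ℝ} (hp : 0 < p) : Summable (cmpWeight p) := by
  refine summable_of_ratio_test_tendsto_lt_one (l := 0) one_pos
    (Eventually.of_forall fun k => (cmpWeight_pos p k).ne') ?_
  have h : Tendsto (fun k : ℕ => ((k : ℝ) + 1) ^ (-p)) atTop (𝓝 0) :=
    (tendsto_rpow_neg_atTop hp).comp
      (tendsto_atTop_add_const_right _ 1 tendsto_natCast_atTop_atTop)
  refine h.congr fun k => ?_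
  rw [Real.norm_of_nonneg (cmpWeight_pos p _).le, Real.norm_of_nonneg (cmpWeight_pos p _).le,
    cmpWeight_succ, mul_div_cancel_left₀ _ (cmpWeight_pos p k).ne']

/-- The normalizing constant of the Conway–Maxwell–Poisson law. -/
noncomputable def cmpMass (p : ℝ) : ℝ := ∑' k, cmpWeight p k

theorem sum_cmpWeight_le {p : ℝ} (hp : 0 < p) (s : Finset ℕ) :
    ∑ k ∈ s, cmpWeight p k ≤ cmpMass p :=
  (summable_cmpWeight hp).sum_le_tsum s fun k _ => (cmpWeight_pos p k).le

theorem one_le_sum_cmpWeight (p : ℝ) (N : ℕ) :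
    1 ≤ ∑ k ∈ Finset.range (N + 1), cmpWeight p k := by
  rw [← cmpWeight_zero p]
  exact Finset.single_le_sum (f := cmpWeight p) (fun k _ => (cmpWeight_pos p k).le) (by simp)

theorem one_le_cmpMass {p : ℝ} (hp : 0 < p) : 1 ≤ cmpMass p :=
  (one_le_sum_cmpWeight p 0).trans (sum_cmpWeight_le hp _)

theorem cmpWeight_tail_le {p : ℝ} (hp : 0 < p) (k N : ℕ) :
    (∑ j ∈ Finset.Ico (k + 1) (N + 1), cmpWeight p j) * ((k : ℝ) + 1) ^ p ≤
      cmpMass p * cmpWeight p k := by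
  have h1 : ∑ j ∈ Finset.Ico (k + 1) (N + 1), cmpWeight p j ≤
      cmpWeight p (k + 1) * cmpMass p := by
    rw [Finset.sum_Ico_eq_sum_range]
    calc _ ≤ ∑ i ∈ Finset.range (N + 1 - (k + 1)), cmpWeight p (k + 1) * cmpWeight p i :=
          Finset.sum_le_sum fun i _ => cmpWeight_add_le hp _ _
      _ = cmpWeight p (k + 1) * ∑ i ∈ Finset.range (N + 1 - (k + 1)), cmpWeight p i := by
          rw [Finset.mul_sum]
      _ ≤ _ := mul_le_mul_of_nonneg_left (sum_cmpWeight_le hp _) (cmpWeight_pos p _).le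
  refine (mul_le_mul_of_nonneg_right h1 (by positivity)).trans_eq ?_
  rw [cmpWeight_succ, Real.rpow_neg (by positivity)]
  have : ((k : ℝ) + 1) ^ p ≠ 0 := by positivity
  field_simp

/-- Abel summation; since ψ starts at 0, no boundary term remains. -/
theorem sum_mul_eq_sum_tail_mul_sub (w ψ : ℕ → ℝ) (h0 : ψ 0 = 0) (N : ℕ) :
    ∑ k ∈ Finset.range (N + 1), w k * ψ k =
      ∑ k ∈ Finset.range N, (∑ j ∈ Finset.Ico (k + 1) (N + 1), w j) * (ψ (k + 1) - ψ k) := by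
  induction N with
  | zero => simp [h0]
  | succ N ih =>
    have h : ∀ k ∈ Finset.range (N + 1),
        (∑ j ∈ Finset.Ico (k + 1) (N + 1 + 1), w j) * (ψ (k + 1) - ψ k) =
        (∑ j ∈ Finset.Ico (k + 1) (N + 1), w j) * (ψ (k + 1) - ψ k) +
          w (N + 1) * (ψ (k + 1) - ψ k) := by
      intro k hk
      rw [Finset.sum_Ico_succ_top (by simpa using hk)]; ring
    rw [Finset.sum_range_succ, ih, Finset.sum_congr rfl h, Finset.sum_add_distrib,
      ← Finset.mul_sum, Finset.sum_range_sub, h0, Finset.sum_range_succ _ N]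
    simp

/-- A Hardy type inequality for the weights `(k!)⁻ᵖ`. -/
theorem cmpWeight_hardy {p ε K : ℝ} (hp : 0 < p) (hε : 0 < ε)
    (hεZ : ε * cmpMass p ≤ 1 / 2) (hK : 0 ≤ K) {ψ D : ℕ → ℝ} (h0 : ψ 0 = 0) (hψ : ∀ k, 0 ≤ ψ k)
    (hD : ∀ k, 0 ≤ D k) (N : ℕ)
    (h : ∀ k < N, ψ (k + 1) - ψ k ≤ ((k : ℝ) + 1) ^ p * (ε * ψ k + K * D k)) :
    ∑ k ∈ Finset.range (N + 1), cmpWeight p k * ψ k ≤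
      2 * cmpMass p * K * ∑ k ∈ Finset.range N, cmpWeight p k * D k := by
  have hZ : 0 ≤ cmpMass p := zero_le_one.trans (one_le_cmpMass hp)
  -- The tail bound cancels the factor (k + 1)^p, and ε times the mass is at most 1/2, so half of
  -- the left side reappears on the right and is absorbed.
  have h1 : ∑ k ∈ Finset.range (N + 1), cmpWeight p k * ψ k ≤
      ∑ k ∈ Finset.range N, (1 / 2 * (cmpWeight p k * ψ k) +
        cmpMass p * K * (cmpWeight p k * D k)) := by
    rw [sum_mul_eq_sum_tail_mul_sub _ _ h0]
    refine Finset.sum_le_sum fun k hk => ?_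
    have hT : 0 ≤ ∑ j ∈ Finset.Ico (k + 1) (N + 1), cmpWeight p j :=
      Finset.sum_nonneg fun j _ => (cmpWeight_pos p j).le
    have hw := cmpWeight_pos p k
    have hb : 0 ≤ ε * ψ k + K * D k :=
      add_nonneg (mul_nonneg hε.le (hψ k)) (mul_nonneg hK (hD k))
    calc _ ≤ (∑ j ∈ Finset.Ico (k + 1) (N + 1), cmpWeight p j) *
          (((k : ℝ) + 1) ^ p * (ε * ψ k + K * D k)) :=
          mul_le_mul_of_nonneg_left (h k (by simpa using hk)) hT
      _ = (∑ j ∈ Finset.Ico (k + 1) (N + 1), cmpWeight p j) * ((k : ℝ) + 1) ^ p *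
          (ε * ψ k + K * D k) := by ring
      _ ≤ cmpMass p * cmpWeight p k * (ε * ψ k + K * D k) :=
          mul_le_mul_of_nonneg_right (cmpWeight_tail_le hp k N) hb
      _ = ε * cmpMass p * (cmpWeight p k * ψ k) + cmpMass p * K * (cmpWeight p k * D k) := by ring
      _ ≤ _ := by
          gcongr
          exact mul_nonneg hw.le (hψ k)
  rw [Finset.sum_add_distrib, ← Finset.mul_sum, ← Finset.mul_sum] at h1
  have h2 : ∑ k ∈ Finset.range N, cmpWeight p k * ψ k ≤
      ∑ k ∈ Finset.range (N + 1), cmpWeight p k * ψ k := by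
    rw [Finset.sum_range_succ]
    linarith [mul_nonneg (cmpWeight_pos p N).le (hψ N)]
  linarith

/-! ### The parts of a function below and above 1. -/

theorem klFun_le_sq {v : ℝ} (hv : 0 < v) : InformationTheory.klFun v ≤ (1 - v) ^ 2 := by
  have := mul_le_mul_of_nonneg_left (Real.log_le_sub_one_of_pos hv) hv.le
  rw [InformationTheory.klFun_apply]; linarith

/-- Below 1 `klFun` is dominated by a square and the energy dominates the squared increment, so this
is an ordinary Hardy inequality for (1 - v)². -/
theorem sum_klFun_le_of_le_one {p s : ℝ} (hp : 0 < p) (hs : 1 < s) :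
    ∃ C : ℝ, 0 ≤ C ∧ ∀ (v : ℕ → ℝ) (N : ℕ), v 0 = 1 → (∀ k, 0 < v k) → (∀ k, v k ≤ 1) →
      ∑ k ∈ Finset.range (N + 1), cmpWeight p k * InformationTheory.klFun (v k) ≤
        C * ∑ k ∈ Finset.range N, cmpWeight p k * pairEnergy s (v k) (v (k + 1)) := by
  have hZ := one_le_cmpMass hp
  set κ := min 1 (s - 1) with hκ
  have hκ0 : 0 < κ := lt_min one_pos (by linarith)
  set ε := 1 / (2 * cmpMass p) with hε
  have hε0 : 0 < ε := by positivity
  have hεZ : ε * cmpMass p ≤ 1 / 2 := by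
    rw [hε]; field_simp; rfl
  refine ⟨2 * cmpMass p * ((1 + 1 / ε) / κ), by positivity, fun v N h0 hv hv1 => ?_⟩
  refine (Finset.sum_le_sum fun k _ => mul_le_mul_of_nonneg_left (klFun_le_sq (hv k))
    (cmpWeight_pos p k).le).trans ?_
  refine cmpWeight_hardy hp hε0 hεZ (by positivity) (by simp [h0]) (fun k => sq_nonneg _)
    (fun k => pairEnergy_nonneg hs (hv k) (hv (k + 1))) N fun k _ => ?_
  have h1 := sq_sub_le_pairEnergy hs (hv k) (hv (k + 1)) (hv1 k) (hv1 (k + 1))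
  rw [← hκ] at h1
  set E := pairEnergy s (v k) (v (k + 1))
  have hE : 0 ≤ E := pairEnergy_nonneg hs (hv k) (hv (k + 1))
  have h2 : (v (k + 1) - v k) ^ 2 ≤ E / κ := by
    rw [le_div_iff₀ hκ0]; linarith
  have h3 : (1 - v (k + 1)) ^ 2 - (1 - v k) ^ 2 ≤
      ε * (1 - v k) ^ 2 + (1 + 1 / ε) * (v (k + 1) - v k) ^ 2 := by
    have : 0 ≤ (ε * (1 - v k) + (v (k + 1) - v k)) ^ 2 / ε := by positivity
    have e : (ε * (1 - v k) + (v (k + 1) - v k)) ^ 2 / ε = ε * (1 - v k) ^ 2 +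
        2 * (1 - v k) * (v (k + 1) - v k) + 1 / ε * (v (k + 1) - v k) ^ 2 := by
      field_simp; ring
    linarith
  have hm : 1 ≤ ((k : ℝ) + 1) ^ p :=
    Real.one_le_rpow (by linarith [k.cast_nonneg (α := ℝ)]) hp.le
  calc _ ≤ ε * (1 - v k) ^ 2 + (1 + 1 / ε) * (v (k + 1) - v k) ^ 2 := h3
    _ ≤ ε * (1 - v k) ^ 2 + (1 + 1 / ε) * (E / κ) := by gcongr
    _ = ε * (1 - v k) ^ 2 + (1 + 1 / ε) / κ * E := by ring
    _ ≤ _ := le_mul_of_one_le_left (by positivity) hm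

/-- Functions of bounded energy grow at most like `2 ^ k * (k!) ^ p`. -/
theorem le_two_pow_div_cmpWeight {p s : ℝ} (hp : 0 < p) (hs : 1 < s) {u : ℕ → ℝ} {N : ℕ}
    (h0 : u 0 = 1) (hu : ∀ k, 0 < u k)
    (hE : ∑ k ∈ Finset.range N, cmpWeight p k * pairEnergy s (u k) (u (k + 1)) ≤ 1) {k : ℕ}
    (hk : k ≤ N) : u k ≤ 2 ^ k * (4 / (min 1 (s - 1) * cmpWeight p k)) := by
  set κ := min 1 (s - 1) with hκ
  have hκ0 : 0 < κ := lt_min one_pos (by linarith)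
  induction k with
  | zero =>
    have : κ ≤ 1 := min_le_left _ _
    rw [h0, cmpWeight_zero, pow_zero, one_mul, mul_one, le_div_iff₀ hκ0]; linarith
  | succ k ih =>
    have ih := ih (by omega)
    have hw := cmpWeight_pos p k
    have hw' := cmpWeight_pos p (k + 1)
    have hww := cmpWeight_succ_le hp k
    have hmono : 4 / (κ * cmpWeight p k) ≤ 4 / (κ * cmpWeight p (k + 1)) := by gcongr
    -- Either the value at most doubles, or this single edge has energy at least κ u(k+1) / 4, which
    -- the total budget 1 turns into a bound on u(k+1).
    rcases le_total (u (k + 1)) (2 * u k) with h | h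
    · calc u (k + 1) ≤ 2 * (2 ^ k * (4 / (κ * cmpWeight p k))) := by linarith
        _ = 2 ^ (k + 1) * (4 / (κ * cmpWeight p k)) := by ring
        _ ≤ _ := by gcongr
    · have hk1 : cmpWeight p k * pairEnergy s (u k) (u (k + 1)) ≤ 1 := by
        refine le_trans ?_ hE
        exact Finset.single_le_sum
          (f := fun k => cmpWeight p k * pairEnergy s (u k) (u (k + 1)))
          (fun j _ => mul_nonneg (cmpWeight_pos p j).le (pairEnergy_nonneg hs (hu _) (hu _)))
          (Finset.mem_range.2 hk)
      have huk := hu k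
      have huk1 := hu (k + 1)
      have h1 := le_pairEnergy hs huk (show u k ≤ u (k + 1) by linarith)
      rw [← hκ] at h1
      have h2 : 1 / 2 ≤ 1 - u k / u (k + 1) := by
        have : u k / u (k + 1) ≤ 1 / 2 := by
          rw [div_le_div_iff₀ huk1 two_pos]; linarith
        linarith
      have h3 : u (k + 1) / u k ≤ (u (k + 1) / u k) ^ s :=
        Real.self_le_rpow_of_one_le (by rw [one_le_div huk]; linarith) hs.le
      have h4 : κ * (u (k + 1) / 4) ≤ pairEnergy s (u k) (u (k + 1)) := by
        refine le_trans ?_ h1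
        calc κ * (u (k + 1) / 4) = κ * (u k * (u (k + 1) / u k) * (1 / 2) ^ 2) := by
              field_simp; norm_num
          _ ≤ _ := by gcongr
      have h5 : u (k + 1) ≤ 4 / (κ * cmpWeight p k) := by
        rw [le_div_iff₀ (by positivity)]
        nlinarith [mul_le_mul_of_nonneg_left h4 hw.le]
      calc u (k + 1) ≤ 1 * (4 / (κ * cmpWeight p (k + 1))) := by linarith
        _ ≤ _ := by
          gcongr
          exact one_le_pow₀ (by norm_num)

/-- Growth of order 2^k (k!)^p makes the logarithm O(k log k), and (k + 1)^(p s) dominates this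
because p s > 1. This is where strict inequality between the exponents matters. -/
theorem log_le_of_energy_le_one {p s : ℝ} (hp : 0 < p) (hp1 : p < 1) (hs : 1 < s)
    (hps : 1 < p * s) :
    ∃ B : ℝ, 0 ≤ B ∧ ∀ (u : ℕ → ℝ) (N : ℕ), u 0 = 1 → (∀ k, 0 < u k) →
      ∑ k ∈ Finset.range N, cmpWeight p k * pairEnergy s (u k) (u (k + 1)) ≤ 1 →
      ∀ k ≤ N, Real.log (u k) ≤ B * (((k : ℝ) + 1) ^ p) ^ s := by
  set κ := min 1 (s - 1) with hκ
  have hκ0 : 0 < κ := lt_min one_pos (by linarith)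
  have hκ1 : κ ≤ 1 := min_le_left _ _
  set η := p * s - 1 with hη
  have hη0 : 0 < η := by linarith
  have hlog4 : 0 ≤ Real.log (4 / κ) :=
    Real.log_nonneg (by rw [le_div_iff₀ hκ0]; linarith)
  -- The three summands pay for 2^k, for the constant 4 / κ, and for log k! via log x ≤ x^η / η.
  refine ⟨1 + Real.log (4 / κ) + 1 / η, by positivity, fun u N h0 hu hE k hk => ?_⟩
  have hk0 : (0 : ℝ) ≤ k := k.cast_nonneg
  set x : ℝ := (k : ℝ) + 1 with hx
  have hx1 : 1 ≤ x := by linarith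
  have hx0 : 0 < x := by linarith
  have hfac : Real.log (k ! : ℕ) ≤ x * Real.log x := by
    have h1 : ((k ! : ℕ) : ℝ) ≤ x ^ k := by
      calc ((k ! : ℕ) : ℝ) ≤ (k : ℝ) ^ k := by exact_mod_cast Nat.factorial_le_pow k
        _ ≤ x ^ k := by gcongr; linarith
    calc Real.log (k ! : ℕ) ≤ Real.log (x ^ k) :=
          Real.log_le_log (by exact_mod_cast k.factorial_pos) h1
      _ = k * Real.log x := Real.log_pow _ _
      _ ≤ _ := mul_le_mul_of_nonneg_right (by linarith) (Real.log_nonneg hx1)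
  have hfac0 : 0 ≤ Real.log (k ! : ℕ) :=
    Real.log_nonneg (by exact_mod_cast k.factorial_pos)
  have hw := cmpWeight_pos p k
  have h1 := Real.log_le_log (hu k) (le_two_pow_div_cmpWeight hp hs h0 hu hE hk)
  rw [← hκ, ← div_div, Real.log_mul (by positivity) (by positivity), Real.log_pow,
    Real.log_div (by positivity) hw.ne', cmpWeight,
    Real.log_rpow (by exact_mod_cast k.factorial_pos)] at h1
  have hlog2 : Real.log 2 ≤ 1 := by linarith [Real.log_two_lt_d9]
  have h2 : p * Real.log (k ! : ℕ) ≤ x * Real.log x :=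
    (mul_le_of_le_one_left hfac0 hp1.le).trans hfac
  have h3 := Real.log_le_rpow_div hx0.le hη0
  have hpow : x * x ^ η = (x ^ p) ^ s := by
    rw [← Real.rpow_mul hx0.le, mul_comm, ← Real.rpow_add_one hx0.ne']; congr 1; ring
  have hxle : x ≤ (x ^ p) ^ s := by
    rw [← Real.rpow_mul hx0.le]; exact Real.self_le_rpow_of_one_le hx1 hps.le
  have h4 : x * Real.log x ≤ 1 / η * (x ^ p) ^ s := by
    calc x * Real.log x ≤ x * (x ^ η / η) := by gcongr
      _ = 1 / η * (x ^ p) ^ s := by rw [← hpow]; ring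
  have h5 : (k : ℝ) * Real.log 2 ≤ (x ^ p) ^ s := by
    calc (k : ℝ) * Real.log 2 ≤ k * 1 := by gcongr
      _ ≤ _ := by linarith
  have h6 : Real.log (4 / κ) ≤ Real.log (4 / κ) * (x ^ p) ^ s :=
    le_mul_of_one_le_right hlog4 (hx1.trans hxle)
  linarith

theorem sum_klFun_le_of_one_le {p s : ℝ} (hp : 0 < p) (hp1 : p < 1) (hs : 1 < s)
    (hps : 1 < p * s) :
    ∃ C : ℝ, 0 ≤ C ∧ ∀ (u : ℕ → ℝ) (N : ℕ), u 0 = 1 → (∀ k, 1 ≤ u k) →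
      ∑ k ∈ Finset.range N, cmpWeight p k * pairEnergy s (u k) (u (k + 1)) ≤ 1 →
      ∑ k ∈ Finset.range (N + 1), cmpWeight p k * InformationTheory.klFun (u k) ≤
        C * ∑ k ∈ Finset.range N, cmpWeight p k * pairEnergy s (u k) (u (k + 1)) := by
  have hZ := one_le_cmpMass hp
  set ε := 1 / (2 * cmpMass p) with hε
  have hε0 : 0 < ε := by positivity
  have hε1 : ε ≤ 1 := by rw [hε, div_le_one (by positivity)]; linarith
  have hεZ : ε * cmpMass p ≤ 1 / 2 := by
    rw [hε]; field_simp; rfl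
  obtain ⟨B, hB, hlog⟩ := log_le_of_energy_le_one hp hp1 hs hps
  obtain ⟨K, hK, hinc⟩ := klFun_increment_le hs hB hε0 hε1
  refine ⟨2 * cmpMass p * K, by positivity, fun u N h0 hu hE => ?_⟩
  have hu0 : ∀ k, 0 < u k := fun k => zero_lt_one.trans_le (hu k)
  refine cmpWeight_hardy (ψ := fun k => InformationTheory.klFun (u k)) hp hε0 hεZ hK
    (by simp [h0, InformationTheory.klFun_one]) (fun k => InformationTheory.klFun_nonneg (hu0 k).le)
    (fun k => pairEnergy_nonneg hs (hu0 k) (hu0 (k + 1))) N fun k hk => ?_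
  exact hinc _ _ _ (Real.one_le_rpow (by linarith [k.cast_nonneg (α := ℝ)]) hp.le) (hu k)
    (hu (k + 1)) (hlog u N h0 hu0 hE k hk.le)

/-! ### The entropy inequality on {0, …, N}. -/

/-- The variational bound for entropy: the right side exceeds the left by a quantity that log x ≤ x
- 1, at x = c M / m, shows to be nonnegative. The freedom in c is what permits the normalization
below. -/
theorem sum_mul_log_sub_le_sum_klFun (w g : ℕ → ℝ) (t : Finset ℕ) (hw : ∀ k, 0 < w k)
    (hg : ∀ k, 0 < g k) (ht : t.Nonempty) {c : ℝ} (hc : 0 < c) :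
    ∑ k ∈ t, w k * (g k * Real.log (g k)) -
      (∑ k ∈ t, w k * g k) * Real.log ((∑ k ∈ t, w k * g k) / ∑ k ∈ t, w k) ≤
      c * ∑ k ∈ t, w k * InformationTheory.klFun (g k / c) := by
  set m := ∑ k ∈ t, w k * g k with hm
  set M := ∑ k ∈ t, w k with hM
  have hm0 : 0 < m := Finset.sum_pos (fun k _ => mul_pos (hw k) (hg k)) ht
  have hM0 : 0 < M := Finset.sum_pos (fun k _ => hw k) ht
  have h1 : c * ∑ k ∈ t, w k * InformationTheory.klFun (g k / c) =
      ∑ k ∈ t, w k * (g k * Real.log (g k)) - m * Real.log c + c * M - m := by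
    rw [hm, hM, Finset.mul_sum, Finset.mul_sum, Finset.sum_mul, ← Finset.sum_sub_distrib,
      ← Finset.sum_add_distrib, ← Finset.sum_sub_distrib]
    refine Finset.sum_congr rfl fun k _ => ?_
    rw [InformationTheory.klFun_apply, Real.log_div (hg k).ne' hc.ne']
    field_simp
  have h2 : Real.log (c * M / m) ≤ c * M / m - 1 := Real.log_le_sub_one_of_pos (by positivity)
  rw [Real.log_div (by positivity) hm0.ne', Real.log_mul hc.ne' hM0.ne'] at h2
  have h3 := mul_le_mul_of_nonneg_left h2 hm0.le
  rw [mul_sub m (c * M / m), mul_div_cancel₀ _ hm0.ne'] at h3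
  rw [h1, Real.log_div hm0.ne' hM0.ne']
  linarith

/-- The log-Sobolev inequality for the weights `(k!)⁻ᵖ` restricted to `{0, …, N}`, uniformly
in `N`. -/
theorem sum_entropy_le_sum_pairEnergy {p s : ℝ} (hp : 0 < p) (hp1 : p < 1) (hs : 1 < s)
    (hps : 1 < p * s) :
    ∃ C : ℝ, 0 < C ∧ ∀ (g : ℕ → ℝ) (N : ℕ), (∀ k, 0 < g k) →
      ∑ k ∈ Finset.range (N + 1), cmpWeight p k * (g k * Real.log (g k)) -
        (∑ k ∈ Finset.range (N + 1), cmpWeight p k * g k) *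
          Real.log ((∑ k ∈ Finset.range (N + 1), cmpWeight p k * g k) /
            ∑ k ∈ Finset.range (N + 1), cmpWeight p k) ≤
        C * ∑ k ∈ Finset.range N, cmpWeight p k * pairEnergy s (g k) (g (k + 1)) := by
  obtain ⟨C₁, hC₁, h₁⟩ := sum_klFun_le_of_one_le hp hp1 hs hps
  obtain ⟨C₂, hC₂, h₂⟩ := sum_klFun_le_of_le_one hp hs
  have hZ := one_le_cmpMass hp
  refine ⟨C₁ + (C₂ + cmpMass p), by positivity, fun g N hg => ?_⟩
  have hw := cmpWeight_pos p
  set E := ∑ k ∈ Finset.range N, cmpWeight p k * pairEnergy s (g k) (g (k + 1)) with hE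
  -- After division by c the function starts at a value at most 1 and has energy at most 1, as the
  -- bound above 1 requires.
  set c := max (g 0) E with hc
  have hc0 : 0 < c := (hg 0).trans_le (le_max_left _ _)
  refine (sum_mul_log_sub_le_sum_klFun _ g _ hw hg (by simp) hc0).trans ?_
  set h : ℕ → ℝ := fun k => g k / c with hh
  have hh0 : ∀ k, 0 < h k := fun k => div_pos (hg k) hc0
  have hh1 : h 0 ≤ 1 := (div_le_one hc0).2 (le_max_left _ _)
  have hEh : ∑ k ∈ Finset.range N, cmpWeight p k * pairEnergy s (h k) (h (k + 1)) = E / c := by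
    rw [hE, Finset.sum_div]
    refine Finset.sum_congr rfl fun k _ => ?_
    have := pairEnergy_smul (s := s) (hh0 k).le (hh0 (k + 1)).le hc0
    rw [show c * h k = g k by simp only [hh]; field_simp,
      show c * h (k + 1) = g (k + 1) by simp only [hh]; field_simp] at this
    rw [this]; field_simp
  have hE1 : E / c ≤ 1 := (div_le_one hc0).2 (le_max_right _ _)
  have hE0 : 0 ≤ E := Finset.sum_nonneg fun k _ =>
    mul_nonneg (hw k).le (pairEnergy_nonneg hs (hg _) (hg _))
  have hEc0 : 0 ≤ E / c := by positivity
  have hu : ∑ k ∈ Finset.range N,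
      cmpWeight p k * pairEnergy s (max (h k) 1) (max (h (k + 1)) 1) ≤ E / c := by
    rw [← hEh]
    exact Finset.sum_le_sum fun k _ => mul_le_mul_of_nonneg_left
      (pairEnergy_max_le 1 hs (hh0 _) (hh0 _)) (hw k).le
  have hv : ∑ k ∈ Finset.range N,
      cmpWeight p k * pairEnergy s (min (h k) 1) (min (h (k + 1)) 1) ≤ E / c := by
    rw [← hEh]
    exact Finset.sum_le_sum fun k _ => mul_le_mul_of_nonneg_left
      (pairEnergy_min_le hs (hh0 _) (hh0 _)) (hw k).le
  have hU := (h₁ (fun k => max (h k) 1) N (by simpa using hh1) (fun k => le_max_right _ _)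
    (hu.trans hE1)).trans (mul_le_mul_of_nonneg_left hu hC₁)
  -- If c = g 0, the lower part starts at 1 and the Hardy bound applies. If c = E, the rescaled
  -- energy equals 1 and the trivial bound klFun ≤ 1 on (0, 1] suffices.
  have hV : ∑ k ∈ Finset.range (N + 1),
      cmpWeight p k * InformationTheory.klFun (min (h k) 1) ≤ (C₂ + cmpMass p) * (E / c) := by
    rcases le_total E (g 0) with hEg | hEg
    · have h01 : h 0 = 1 := by
        simp only [hh]; rw [hc, max_eq_left hEg, div_self (hg 0).ne']
      refine (h₂ (fun k => min (h k) 1) N (by simp [h01]) (fun k => lt_min (hh0 k) one_pos)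
        (fun k => min_le_right _ _)).trans ?_
      refine (mul_le_mul_of_nonneg_left hv hC₂).trans ?_
      exact mul_le_mul_of_nonneg_right (by linarith) hEc0
    · have : E / c = 1 := by
        rw [hc, max_eq_right hEg, div_self ((hg 0).trans_le hEg).ne']
      rw [this, mul_one]
      calc _ ≤ ∑ k ∈ Finset.range (N + 1), cmpWeight p k := by
            refine Finset.sum_le_sum fun k _ => mul_le_of_le_one_right (hw k).le ?_
            have hpos : 0 < min (h k) 1 := lt_min (hh0 k) one_pos
            have hle : min (h k) 1 ≤ 1 := min_le_right _ _
            refine (klFun_le_sq hpos).trans ?_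
            nlinarith
        _ ≤ cmpMass p := sum_cmpWeight_le hp _
        _ ≤ _ := by linarith
  -- One of the two truncations equals 1, where `klFun` vanishes.
  have hsplit : ∀ k, InformationTheory.klFun (g k / c) =
      InformationTheory.klFun (max (h k) 1) + InformationTheory.klFun (min (h k) 1) := by
    intro k
    rcases le_total (h k) 1 with h1 | h1
    · rw [max_eq_right h1, min_eq_left h1]; simp [hh, InformationTheory.klFun_one]
    · rw [max_eq_left h1, min_eq_right h1]; simp [hh, InformationTheory.klFun_one]
  simp_rw [hsplit, mul_add]
  rw [Finset.sum_add_distrib]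
  calc _ ≤ c * (C₁ * (E / c) + (C₂ + cmpMass p) * (E / c)) := by gcongr
    _ = _ := by field_simp

theorem pairEnergy_rpow {q a b : ℝ} (hq : 0 < q) (ha : 0 < a) (hb : 0 < b) :
    pairEnergy q⁻¹ (a ^ q) (b ^ q) = -((b - a) * (b ^ (q - 1) - a ^ (q - 1))) := by
  have h1 : ∀ x : ℝ, 0 < x → (x ^ q) ^ q⁻¹ = x := fun x hx => by
    rw [← Real.rpow_mul hx.le, mul_inv_cancel₀ hq.ne', Real.rpow_one]
  have h2 : ∀ x : ℝ, 0 < x → (x ^ q) ^ (1 - q⁻¹) = x ^ (q - 1) := fun x hx => by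
    rw [← Real.rpow_mul hx.le]; congr 1; field_simp
  rw [pairEnergy, h1 a ha, h1 b hb, h2 a ha, h2 b hb]; ring

/-- `sum_entropy_le_sum_pairEnergy` in the form of the `q`-log-Sobolev inequality. -/
theorem sum_entropy_rpow_le {p q : ℝ} (hp1 : p < 1) (hq : 0 < q) (hqp : q < p) :
    ∃ C : ℝ, 0 < C ∧ ∀ (f : ℕ → ℝ) (N : ℕ), (∀ k, 0 < f k) →
      ∑ k ∈ Finset.range (N + 1), cmpWeight p k * (f k ^ q * Real.log (f k ^ q)) -
        (∑ k ∈ Finset.range (N + 1), cmpWeight p k * f k ^ q) *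
          Real.log ((∑ k ∈ Finset.range (N + 1), cmpWeight p k * f k ^ q) /
            ∑ k ∈ Finset.range (N + 1), cmpWeight p k) ≤
        C * q ^ 2 / (4 * (q - 1)) * ∑ k ∈ Finset.range N,
          (f (k + 1) ^ (q - 1) - f k ^ (q - 1)) * (f (k + 1) - f k) * cmpWeight p k := by
  have hs : 1 < q⁻¹ := (one_lt_inv₀ hq).2 (hqp.trans hp1)
  have hps : 1 < p * q⁻¹ := by rw [← div_eq_mul_inv, one_lt_div hq]; exact hqp
  obtain ⟨C, hC, h⟩ := sum_entropy_le_sum_pairEnergy (hq.trans hqp) hp1 hs hps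
  have hq1 : 0 < 1 - q := by linarith
  -- Chosen so that the prefactor C q² / (4 (q - 1)) collapses to minus the constant of the edge
  -- inequality.
  refine ⟨C * (4 * (1 - q)) / q ^ 2, by positivity, fun f N hf => ?_⟩
  refine (h (fun k => f k ^ q) N fun k => Real.rpow_pos_of_pos (hf k) q).trans_eq ?_
  have e : C * (4 * (1 - q)) / q ^ 2 * q ^ 2 / (4 * (q - 1)) = -C := by
    have : q - 1 ≠ 0 := by linarith
    field_simp; ring
  rw [e, neg_mul, ← mul_neg, ← Finset.sum_neg_distrib]
  congr 1
  refine Finset.sum_congr rfl fun k _ => ?_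
  rw [pairEnergy_rpow hq (hf k) (hf (k + 1))]; ring

/-! ### The law on ℕ: validity for smaller exponents. -/

/-- The Conway–Maxwell–Poisson law. -/
noncomputable def cmpMeasure (p : ℝ) : Measure ℕ :=
  Measure.sum fun k => ENNReal.ofReal (cmpWeight p k / cmpMass p) • Measure.dirac k

theorem cmpMeasure_singleton (p : ℝ) (k : ℕ) :
    cmpMeasure p {k} = ENNReal.ofReal (cmpWeight p k / cmpMass p) := by
  rw [cmpMeasure, Measure.sum_apply _ (measurableSet_singleton k), tsum_eq_single k]
  · simp
  · intro j hj
    simp [hj]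

theorem cmpMeasure_real_singleton {p : ℝ} (hp : 0 < p) (k : ℕ) :
    (cmpMeasure p).real {k} = cmpWeight p k / cmpMass p := by
  have := one_le_cmpMass hp
  have := cmpWeight_pos p k
  rw [measureReal_def, cmpMeasure_singleton, ENNReal.toReal_ofReal (by positivity)]

theorem cmpMeasure_singleton_pos {p : ℝ} (hp : 0 < p) (k : ℕ) : 0 < cmpMeasure p {k} := by
  have := one_le_cmpMass hp
  have := cmpWeight_pos p k
  rw [cmpMeasure_singleton, ENNReal.ofReal_pos]; positivity

theorem isProbabilityMeasure_cmpMeasure {p : ℝ} (hp : 0 < p) :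
    IsProbabilityMeasure (cmpMeasure p) := by
  have h1 := one_le_cmpMass hp
  constructor
  rw [cmpMeasure, Measure.sum_apply _ MeasurableSet.univ]
  simp only [Measure.smul_apply, measure_univ, smul_eq_mul, mul_one]
  rw [← ENNReal.ofReal_tsum_of_nonneg (fun k => by have := cmpWeight_pos p k; positivity)
    ((summable_cmpWeight hp).div_const _), tsum_div_const]
  change ENNReal.ofReal (cmpMass p / cmpMass p) = 1
  rw [div_self (by positivity), ENNReal.ofReal_one]

theorem integrable_cmpMeasure_iff {p : ℝ} (hp : 0 < p) (f : ℕ → ℝ) :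
    Integrable f (cmpMeasure p) ↔ Summable fun k => cmpWeight p k * f k := by
  have h1 := one_le_cmpMass hp
  rw [cmpMeasure, integrable_sum_dirac_iff (fun _ => ENNReal.ofReal_ne_top),
    ← summable_mul_left_iff (a := (cmpMass p)⁻¹) (by positivity) (f := fun k => cmpWeight p k * f k),
    ← summable_abs_iff (f := fun k => (cmpMass p)⁻¹ * (cmpWeight p k * f k))]
  refine summable_congr fun k => ?_
  have := cmpWeight_pos p k
  rw [ENNReal.toReal_ofReal (by positivity), abs_mul, abs_mul, abs_of_pos this,
    abs_of_pos (by positivity), Real.norm_eq_abs]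
  ring

theorem integral_cmpMeasure {p : ℝ} (hp : 0 < p) (f : ℕ → ℝ) :
    ∫ k, f k ∂cmpMeasure p = (∑' k, cmpWeight p k * f k) / cmpMass p := by
  by_cases h : Integrable f (cmpMeasure p)
  · have h1 := one_le_cmpMass hp
    have := (hasSum_integral_measure h).tsum_eq
    change _ = ∫ k, f k ∂cmpMeasure p at this
    rw [← this, ← tsum_div_const]
    refine tsum_congr fun k => ?_
    have := cmpWeight_pos p k
    rw [integral_smul_measure, integral_dirac, ENNReal.toReal_ofReal (by positivity), smul_eq_mul]
    ring
  · rw [integral_undef h, tsum_eq_zero_of_not_summable, zero_div]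
    rwa [← integrable_cmpMeasure_iff hp]

theorem ent_cmpMeasure {p : ℝ} (hp : 0 < p) (g : ℕ → ℝ) :
    Ent (cmpMeasure p) g = ((∑' k, cmpWeight p k * (g k * Real.log (g k))) -
      (∑' k, cmpWeight p k * g k) * Real.log ((∑' k, cmpWeight p k * g k) / cmpMass p)) /
        cmpMass p := by
  rw [Ent, integral_cmpMeasure hp, integral_cmpMeasure hp]; ring

theorem birthDeathForm_cmpMeasure {p : ℝ} (hp : 0 < p) (f g : ℕ → ℝ) :
    birthDeathForm (cmpMeasure p) f g =
      (∑' k, (f (k + 1) - f k) * (g (k + 1) - g k) * cmpWeight p k) / cmpMass p := by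
  rw [birthDeathForm, ← tsum_div_const]
  refine tsum_congr fun k => ?_
  rw [cmpMeasure_real_singleton hp]; ring

theorem summable_mul_of_summable_sq {a b w : ℕ → ℝ} (hw : ∀ k, 0 ≤ w k)
    (ha : Summable fun k => a k ^ 2 * w k) (hb : Summable fun k => b k ^ 2 * w k) :
    Summable fun k => a k * b k * w k := by
  refine Summable.of_norm_bounded (ha.add hb) fun k => ?_
  rw [Real.norm_eq_abs, abs_le]
  have := hw k
  constructor
  · nlinarith [mul_nonneg (hw k) (sq_nonneg (a k + b k)), mul_nonneg (hw k) (sq_nonneg (a k)),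
      mul_nonneg (hw k) (sq_nonneg (b k))]
  · nlinarith [mul_nonneg (hw k) (sq_nonneg (a k - b k)), mul_nonneg (hw k) (sq_nonneg (a k)),
      mul_nonneg (hw k) (sq_nonneg (b k))]

theorem summable_birthDeath_energy {p : ℝ} (hp : 0 < p) {f g : ℕ → ℝ}
    (hf : f ∈ birthDeathDomain (cmpMeasure p)) (hg : g ∈ birthDeathDomain (cmpMeasure p)) :
    Summable fun k => (f (k + 1) - f k) * (g (k + 1) - g k) * cmpWeight p k := by
  have hZ := one_le_cmpMass hp
  have hsum : ∀ h : ℕ → ℝ, h ∈ birthDeathDomain (cmpMeasure p) →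
      Summable fun k => (h (k + 1) - h k) ^ 2 * cmpWeight p k := by
    intro h hh
    have := hh.2.mul_right (cmpMass p)
    refine this.congr fun k => ?_
    rw [cmpMeasure_real_singleton hp]; field_simp
  exact summable_mul_of_summable_sq (a := fun k => f (k + 1) - f k)
    (b := fun k => g (k + 1) - g k) (w := cmpWeight p) (fun k => (cmpWeight_pos p k).le)
    (hsum f hf) (hsum g hg)

theorem birthDeathLogSobolev_cmpMeasure {p q : ℝ} (hp1 : p < 1) (hq : 0 < q) (hqp : q < p) :
    BirthDeathLogSobolev (cmpMeasure p) q := by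
  have hp : 0 < p := hq.trans hqp
  have hZ := one_le_cmpMass hp
  have hZ0 : 0 < cmpMass p := by linarith
  obtain ⟨C, hC, h⟩ := sum_entropy_rpow_le hp1 hq hqp
  refine ⟨C, hC, ?_⟩
  rw [LogSobolevWith, if_neg (by linarith)]
  intro f hf hpos hf'
  rw [ent_cmpMeasure hp, birthDeathForm_cmpMeasure hp, ← mul_div_assoc]
  refine div_le_div_of_nonneg_right ?_ hZ0.le
  have hw := cmpWeight_pos p
  set e : ℕ → ℝ := fun k =>
    (f (k + 1) ^ (q - 1) - f k ^ (q - 1)) * (f (k + 1) - f k) * cmpWeight p k with he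
  set g : ℕ → ℝ := fun k => f k ^ q with hg
  have he_sum : Summable e :=
    summable_birthDeath_energy hp (f := fun k => f k ^ (q - 1)) (g := f) hf' hf
  -- f^q is the product of the square-integrable functions f and f^(q-1).
  have hg_sum : Summable fun k => cmpWeight p k * g k := by
    rw [← integrable_cmpMeasure_iff hp]
    refine (hf.1.integrable_mul hf'.1).congr (Eventually.of_forall fun k => ?_)
    simp only [Pi.mul_apply, hg]
    nth_rw 1 [← Real.rpow_one (f k)]
    rw [← Real.rpow_add (hpos k)]; congr 1; ring
  have hm0 : 0 < ∑' k, cmpWeight p k * g k :=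
    hg_sum.tsum_pos (fun k => mul_nonneg (hw k).le (Real.rpow_nonneg (hpos k).le _)) 0
      (mul_pos (hw 0) (Real.rpow_pos_of_pos (hpos 0) _))
  have hshift : ∀ {u : ℕ → ℝ}, Summable u →
      Tendsto (fun N => ∑ k ∈ Finset.range (N + 1), u k) atTop (𝓝 (∑' k, u k)) := fun hu =>
    hu.hasSum.tendsto_sum_nat.comp (tendsto_add_atTop_nat 1)
  have hmN := hshift hg_sum
  have hMN := hshift (summable_cmpWeight hp)
  have hR : Tendsto (fun N => C * q ^ 2 / (4 * (q - 1)) * ∑ k ∈ Finset.range N, e k +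
      (∑ k ∈ Finset.range (N + 1), cmpWeight p k * g k) *
          Real.log ((∑ k ∈ Finset.range (N + 1), cmpWeight p k * g k) /
            ∑ k ∈ Finset.range (N + 1), cmpWeight p k)) atTop
      (𝓝 (C * q ^ 2 / (4 * (q - 1)) * (∑' k, e k) + (∑' k, cmpWeight p k * g k) *
        Real.log ((∑' k, cmpWeight p k * g k) / cmpMass p))) := by
    refine (he_sum.hasSum.tendsto_sum_nat.const_mul _).add (hmN.mul ?_)
    exact (hmN.div hMN hZ0.ne').log (by positivity)
  have hle : ∀ N, ∑ k ∈ Finset.range (N + 1), cmpWeight p k * (g k * Real.log (g k)) ≤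
      C * q ^ 2 / (4 * (q - 1)) * ∑ k ∈ Finset.range N, e k +
      (∑ k ∈ Finset.range (N + 1), cmpWeight p k * g k) *
          Real.log ((∑ k ∈ Finset.range (N + 1), cmpWeight p k * g k) /
            ∑ k ∈ Finset.range (N + 1), cmpWeight p k) := fun N => by
    linarith [h f N hpos]
  -- Needed so that the infinite sum is not a default 0. Since g log g + 1 ≥ 0, bounded partial sums
  -- suffice, and the finite inequalities bound them.
  have hlog_sum : Summable fun k => cmpWeight p k * (g k * Real.log (g k)) := by
    obtain ⟨b, hb⟩ := (hR.add hMN).bddAbove_range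
    have hnn : ∀ k, 0 ≤ cmpWeight p k * (g k * Real.log (g k)) + cmpWeight p k := fun k => by
      have h0 : 0 ≤ g k := Real.rpow_nonneg (hpos k).le _
      have := InformationTheory.klFun_nonneg h0
      rw [InformationTheory.klFun_apply] at this
      nlinarith [hw k]
    have : Summable fun k => cmpWeight p k * (g k * Real.log (g k)) + cmpWeight p k := by
      refine summable_of_sum_range_le (c := b) hnn fun n => ?_
      refine le_trans ?_ (hb ⟨n, rfl⟩)
      refine (Finset.sum_le_sum_of_subset_of_nonneg
        (Finset.range_mono n.le_succ) fun k _ _ => hnn k).trans ?_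
      rw [Finset.sum_add_distrib]
      exact add_le_add_left (hle n) _
    refine (this.sub (summable_cmpWeight hp)).congr fun k => ?_
    ring
  have := le_of_tendsto_of_tendsto' (hshift hlog_sum) hR hle
  linarith

/-! ### Failure at the critical exponent. -/

/-- One term of the exponential series at e^L. The slope L is arbitrary, so log k! is superlinear.
-/
theorem le_log_factorial (L : ℝ) (k : ℕ) : L * k - Real.exp L ≤ Real.log (k ! : ℕ) := by
  have h := Real.pow_div_factorial_le_exp (Real.exp L) (Real.exp_pos L).le k
  have hk : (0 : ℝ) < (k ! : ℕ) := by exact_mod_cast k.factorial_pos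
  have h2 := Real.log_le_log (by positivity) h
  rw [Real.log_exp, Real.log_div (by positivity) hk.ne', Real.log_pow, Real.log_exp] at h2
  linarith

/-- `∑_{k ≤ n} log k!` dominates every quadratic polynomial in `n`. -/
theorem exists_quadratic_lt_sum_log_factorial {a A K : ℝ} (ha : 0 < a) (hA : 0 ≤ A) (hK : 0 ≤ K) :
    ∃ n : ℕ, A * (n : ℝ) ^ 2 + ((n : ℝ) + 1 + K) ^ 2 <
      a * ∑ k ∈ Finset.range (n + 1), Real.log (k ! : ℕ) := by
  -- This makes a L ∑ k equal to (A + 5) n (n + 1). Of the 5, a share 4 covers (n + 1 + K)² ≤ (2n)²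
  -- and 1 covers the error (n + 1) a e^L.
  set L := 2 * (A + 5) / a with hL
  obtain ⟨n, hn⟩ := exists_nat_gt (1 + K + 2 * a * Real.exp L)
  have hexp := Real.exp_pos L
  have haL : 0 < a * Real.exp L := by positivity
  refine ⟨n, ?_⟩
  have hL0 : 0 ≤ L := by positivity
  have h1 : ∑ k ∈ Finset.range (n + 1), (L * k - Real.exp L) ≤
      ∑ k ∈ Finset.range (n + 1), Real.log (k ! : ℕ) :=
    Finset.sum_le_sum fun k _ => le_log_factorial L k
  have hg : (∑ k ∈ Finset.range (n + 1), (k : ℝ)) * 2 = (n + 1) * n := by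
    have := Finset.sum_range_id_mul_two (n + 1)
    rw [Nat.add_sub_cancel] at this
    have := congrArg (Nat.cast : ℕ → ℝ) this
    push_cast at this
    exact this
  rw [Finset.sum_sub_distrib, ← Finset.mul_sum] at h1
  simp only [Finset.sum_const, Finset.card_range, nsmul_eq_mul, Nat.cast_add, Nat.cast_one] at h1
  set S := ∑ k ∈ Finset.range (n + 1), (k : ℝ)
  have hS : S = (n + 1) * n / 2 := by linarith
  have haL2 : a * L = 2 * (A + 5) := by rw [hL]; field_simp
  have h2 := mul_le_mul_of_nonneg_left h1 ha.le
  have h3 : a * (L * S - (n + 1) * Real.exp L) =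
      (A + 5) * ((n + 1) * n) - (n + 1) * (a * Real.exp L) := by
    rw [hS]; linear_combination ((n + 1) * n / 2 : ℝ) * haL2
  rw [h3] at h2
  refine lt_of_lt_of_le ?_ h2
  have hn1 : 1 + K ≤ n := by linarith
  have hn0 : (1 : ℝ) ≤ n := by linarith
  have h4 : ((n : ℝ) + 1 + K) ^ 2 ≤ (2 * n) ^ 2 := by
    apply pow_le_pow_left₀ <;> linarith
  have h5 : ((n : ℝ) + 1) * (a * Real.exp L) ≤ 2 * n * (a * Real.exp L) := by
    gcongr; linarith
  have h6 : (2 * n : ℝ) * (a * Real.exp L) < n * n := by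
    nlinarith
  nlinarith

/-- The increment of k! is k · k!, and (k!)^(p-1) · k! · w_k = 1; the remaining term has a
favourable sign. -/
theorem neg_factorial_energy_le (p : ℝ) (k : ℕ) :
    -(((((k + 1)! : ℕ) : ℝ) ^ (p - 1) - ((k ! : ℕ) : ℝ) ^ (p - 1)) *
      ((((k + 1)! : ℕ) : ℝ) - ((k ! : ℕ) : ℝ)) * cmpWeight p k) ≤ k := by
  have hk : (0 : ℝ) < (k ! : ℕ) := by exact_mod_cast k.factorial_pos
  have h1 : (((k + 1)! : ℕ) : ℝ) - ((k ! : ℕ) : ℝ) = k * (k ! : ℕ) := by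
    rw [Nat.factorial_succ]; push_cast; ring
  have h2 : (0 : ℝ) ≤ (((k + 1)! : ℕ) : ℝ) ^ (p - 1) := by positivity
  have h3 : ((k ! : ℕ) : ℝ) ^ (p - 1) * (k ! : ℕ) * cmpWeight p k = 1 := by
    rw [cmpWeight, ← Real.rpow_add_one hk.ne', ← Real.rpow_add hk]
    simp
  rw [h1]
  have h4 : 0 ≤ (((k + 1)! : ℕ) : ℝ) ^ (p - 1) * (k * (k ! : ℕ)) * cmpWeight p k := by
    have := cmpWeight_pos p k
    positivity
  have h5 : (k : ℝ) * (((k ! : ℕ) : ℝ) ^ (p - 1) * (k ! : ℕ) * cmpWeight p k) = k * 1 := by rw [h3]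
  linarith

theorem mul_log_div_le_sq {x M : ℝ} (hx : 0 < x) (hM : 1 ≤ M) : x * Real.log (x / M) ≤ x ^ 2 := by
  have h1 : Real.log (x / M) ≤ x := by
    have h2 := Real.log_le_sub_one_of_pos (show 0 < x / M by positivity)
    have h3 : x / M ≤ x := div_le_self hx.le hM
    linarith
  nlinarith

theorem cmpWeight_mul_factorial_rpow (p : ℝ) (k : ℕ) :
    cmpWeight p k * ((k ! : ℕ) : ℝ) ^ p = 1 := by
  have hk : (0 : ℝ) < (k ! : ℕ) := by exact_mod_cast k.factorial_pos
  rw [cmpWeight, ← Real.rpow_add hk]; simp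

theorem sum_range_cast_le_sq (n : ℕ) : ∑ k ∈ Finset.range n, (k : ℝ) ≤ (n : ℝ) ^ 2 := by
  calc _ ≤ ∑ k ∈ Finset.range n, (n : ℝ) :=
        Finset.sum_le_sum fun k hk => by exact_mod_cast (Finset.mem_range.1 hk).le
    _ = _ := by simp [sq]

theorem mem_birthDeathDomain_of_eventually_const {p : ℝ} (hp : 0 < p) {f : ℕ → ℝ} {n : ℕ}
    (hf : ∀ k, f k = f (min k n)) : f ∈ birthDeathDomain (cmpMeasure p) := by
  have := isProbabilityMeasure_cmpMeasure hp
  refine ⟨MemLp.of_bound (measurable_of_countable f).aestronglyMeasurable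
    (∑ k ∈ Finset.range (n + 1), ‖f k‖) (Eventually.of_forall fun k => ?_), ?_⟩
  · rw [hf k]
    exact Finset.single_le_sum (f := fun k => ‖f k‖) (fun k _ => norm_nonneg _)
      (Finset.mem_range.2 (by omega))
  · refine summable_of_ne_finset_zero (s := Finset.range n) fun k hk => ?_
    have hk : n ≤ k := by simpa using hk
    rw [hf (k + 1), hf k, min_eq_right hk, min_eq_right (by omega)]; simp

theorem not_birthDeathLogSobolev_cmpMeasure {p : ℝ} (hp : 0 < p) (hp1 : p < 1) :
    ¬ BirthDeathLogSobolev (cmpMeasure p) p := by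
  rintro ⟨C, hC, h⟩
  have hZ := one_le_cmpMass hp
  have hZ0 : 0 < cmpMass p := by linarith
  have hw := cmpWeight_pos p
  rw [LogSobolevWith, if_neg (by linarith)] at h
  have hp1' : 0 < 1 - p := by linarith
  set A := C * p ^ 2 / (4 * (1 - p)) with hA
  obtain ⟨n, hn⟩ := exists_quadratic_lt_sum_log_factorial hp (A := A) (by positivity) hZ0.le
  -- Freezing the factorial at n puts f and its powers in the form domain and kills the energy
  -- beyond n.
  set f : ℕ → ℝ := fun k => (((min k n)! : ℕ) : ℝ) with hf
  have hf1 : ∀ k, 1 ≤ f k := fun k => by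
    simp only [hf]; exact_mod_cast (min k n).factorial_pos
  have hf0 : ∀ k, 0 < f k := fun k => zero_lt_one.trans_le (hf1 k)
  have h := h f (mem_birthDeathDomain_of_eventually_const hp (n := n) fun k => by simp [hf]) hf0
    (mem_birthDeathDomain_of_eventually_const hp (n := n) fun k => by simp [hf])
  rw [ent_cmpMeasure hp, birthDeathForm_cmpMeasure hp, ← mul_div_assoc,
    div_le_div_iff_of_pos_right hZ0] at h
  have hfk : ∀ k, k ≤ n → f k = (k ! : ℕ) := fun k hk => by simp only [hf, min_eq_left hk]
  have hconst : ∀ u : ℝ → ℝ, Summable fun k => cmpWeight p k * u (f k) := fun u => by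
    have := isProbabilityMeasure_cmpMeasure hp
    rw [← integrable_cmpMeasure_iff hp]
    exact (mem_birthDeathDomain_of_eventually_const (f := fun k => u (f k)) hp (n := n)
      fun k => by simp [hf]).1.integrable one_le_two
  have hE : C * p ^ 2 / (4 * (p - 1)) * (∑' k, (f (k + 1) ^ (p - 1) - f k ^ (p - 1)) *
      (f (k + 1) - f k) * cmpWeight p k) ≤ A * n ^ 2 := by
    rw [tsum_eq_sum (s := Finset.range n)]
    · have e : C * p ^ 2 / (4 * (p - 1)) = -A := by
        rw [hA, show 4 * (p - 1) = -(4 * (1 - p)) by ring, div_neg]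
      rw [e, neg_mul, ← mul_neg, ← Finset.sum_neg_distrib]
      refine mul_le_mul_of_nonneg_left ?_ (by positivity)
      refine le_trans (Finset.sum_le_sum fun k hk => ?_) (sum_range_cast_le_sq n)
      have hk : k < n := Finset.mem_range.1 hk
      rw [hfk k hk.le, hfk (k + 1) hk]
      exact neg_factorial_energy_le p k
    · intro k hk
      have hk : n ≤ k := by simpa using hk
      have : f (k + 1) = f k := by
        simp only [hf]; rw [min_eq_right hk, min_eq_right (by omega)]
      rw [this]; simp
  have hlog : p * ∑ k ∈ Finset.range (n + 1), Real.log (k ! : ℕ) ≤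
      ∑' k, cmpWeight p k * (f k ^ p * Real.log (f k ^ p)) := by
    refine le_trans (le_of_eq ?_) ((hconst fun x => x ^ p * Real.log (x ^ p)).sum_le_tsum
      (Finset.range (n + 1)) fun k _ => mul_nonneg (hw k).le ?_)
    · rw [Finset.mul_sum]
      refine Finset.sum_congr rfl fun k hk => ?_
      rw [hfk k (by simpa [Nat.lt_succ_iff] using hk), ← mul_assoc, cmpWeight_mul_factorial_rpow,
        one_mul, Real.log_rpow (by exact_mod_cast k.factorial_pos)]
    · have := Real.one_le_rpow (hf1 k) hp.le
      exact mul_nonneg (by linarith) (Real.log_nonneg this)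
  have hsum := hconst fun x => x ^ p
  have hm0 : 0 < ∑' k, cmpWeight p k * f k ^ p :=
    hsum.tsum_pos (fun k => mul_nonneg (hw k).le (Real.rpow_nonneg (hf0 k).le _)) 0
      (mul_pos (hw 0) (Real.rpow_pos_of_pos (hf0 0) _))
  -- Each k ≤ n contributes exactly 1. The frozen tail contributes at most the total mass, because
  -- w_{n+k+1} ≤ w_n w_k and w_n (n!)^p = 1.
  have hm : ∑' k, cmpWeight p k * f k ^ p ≤ n + 1 + cmpMass p := by
    rw [← hsum.sum_add_tsum_nat_add (n + 1)]
    refine add_le_add (le_of_eq ?_) ?_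
    · rw [Finset.sum_congr rfl fun k hk => show _ = (1 : ℝ) by
        rw [hfk k (by simpa [Nat.lt_succ_iff] using hk), cmpWeight_mul_factorial_rpow]]
      simp
    · refine ((summable_nat_add_iff (n + 1)).2 hsum).tsum_le_tsum (fun k => ?_)
        (summable_cmpWeight hp)
      have : f (k + (n + 1)) = (n ! : ℕ) := by
        simp only [hf]; rw [min_eq_right (by omega)]
      rw [this]
      have h1 : cmpWeight p (k + (n + 1)) ≤ cmpWeight p n * cmpWeight p k := by
        rw [show k + (n + 1) = n + k + 1 by ring]
        exact (cmpWeight_succ_le hp _).trans (cmpWeight_add_le hp n k)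
      calc _ ≤ cmpWeight p n * cmpWeight p k * ((n ! : ℕ) : ℝ) ^ p := by gcongr
        _ = cmpWeight p n * ((n ! : ℕ) : ℝ) ^ p * cmpWeight p k := by ring
        _ = cmpWeight p k := by rw [cmpWeight_mul_factorial_rpow, one_mul]
  have hm2 := (mul_log_div_le_sq hm0 hZ).trans (pow_le_pow_left₀ hm0.le hm 2)
  linarith

/-! ### Reversible semigroups on finite spaces via matrix exponentials. -/

theorem tendsto_coe_nhdsGT_zero : Tendsto (fun t : ℝ≥0 => (t : ℝ)) (𝓝[>] 0) (𝓝[>] 0) := by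
  refine tendsto_nhdsWithin_iff.2 ⟨?_, ?_⟩
  · exact (NNReal.continuous_coe.tendsto' 0 0 rfl).mono_left nhdsWithin_le_nhds
  · filter_upwards [self_mem_nhdsWithin] with t ht
    exact NNReal.coe_pos.2 ht

section FiniteChain

variable {Ω : Type*} [Fintype Ω] [DecidableEq Ω]

open NormedSpace in
theorem Matrix.hasSum_exp (A : Matrix Ω Ω ℝ) :
    HasSum (fun n : ℕ => ((n ! : ℝ)⁻¹) • A ^ n) (exp A) :=
  open scoped Matrix.Norms.Operator in NormedSpace.exp_series_hasSum_exp' (𝕂 := ℝ) A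

open NormedSpace in
theorem Matrix.hasDerivAt_exp_smul_zero (A : Matrix Ω Ω ℝ) (x y : Ω) :
    HasDerivAt (fun t : ℝ => exp (t • A) x y) (A x y) 0 := by
  open scoped Matrix.Norms.Operator in
  have h := hasDerivAt_exp_smul_const (𝕂 := ℝ) A (0 : ℝ)
  rw [zero_smul, exp_zero, one_mul] at h
  exact hasDerivAt_pi.1 (hasDerivAt_pi.1 h x) y

open NormedSpace in
theorem Matrix.exp_nonneg_of_nonneg (A : Matrix Ω Ω ℝ) (hA : ∀ x y, 0 ≤ A x y) (x y : Ω) :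
    0 ≤ exp A x y := by
  have hpow : ∀ (n : ℕ) (x y : Ω), 0 ≤ (A ^ n) x y := by
    intro n
    induction n with
    | zero => intro x y; rw [pow_zero, Matrix.one_apply]; split_ifs <;> norm_num
    | succ n ih =>
      intro x y
      rw [pow_succ, Matrix.mul_apply]
      exact Finset.sum_nonneg fun z _ => mul_nonneg (ih x z) (hA z y)
  have h := (Pi.hasSum.1 (Pi.hasSum.1 (Matrix.hasSum_exp A) x) y)
  exact h.nonneg fun n => mul_nonneg (by positivity) (hpow n x y)

/-- The exponential of a matrix with nonnegative off-diagonal entries is nonnegative. -/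
theorem Matrix.exp_nonneg_of_offDiag_nonneg (A : Matrix Ω Ω ℝ)
    (hA : ∀ x y, x ≠ y → 0 ≤ A x y) (x y : Ω) : 0 ≤ NormedSpace.exp A x y := by
  -- A shift by c makes every entry nonnegative; being scalar, it commutes and only multiplies the
  -- exponential by e^(-c).
  set c : ℝ := ∑ z, |A z z| with hc
  have hcomm : Commute (A + c • (1 : Matrix Ω Ω ℝ)) ((-c) • (1 : Matrix Ω Ω ℝ)) :=
    (Commute.one_right _).smul_right _
  have hsplit : A = (A + c • (1 : Matrix Ω Ω ℝ)) + (-c) • (1 : Matrix Ω Ω ℝ) := by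
    rw [neg_smul, add_neg_cancel_right]
  have hdiag : NormedSpace.exp ((-c) • (1 : Matrix Ω Ω ℝ)) =
      Matrix.diagonal fun _ => Real.exp (-c) := by
    have : (-c) • (1 : Matrix Ω Ω ℝ) = Matrix.diagonal fun _ => -c := by
      rw [← Matrix.diagonal_one, ← Matrix.diagonal_smul]; simp [Pi.smul_def]
    rw [this, Matrix.exp_diagonal, Real.exp_eq_exp_ℝ]
    congr 1
    ext i
    exact Pi.coe_exp _ _
  rw [hsplit, Matrix.exp_add_of_commute _ _ hcomm, hdiag, Matrix.mul_diagonal]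
  refine mul_nonneg (Matrix.exp_nonneg_of_nonneg _ (fun z w => ?_) x y) (Real.exp_pos _).le
  rw [Matrix.add_apply, Matrix.smul_apply, Matrix.one_apply]
  split_ifs with h
  · subst h
    have h1 : |A z z| ≤ c := Finset.single_le_sum (f := fun z => |A z z|)
      (fun _ _ => abs_nonneg _) (Finset.mem_univ z)
    have := neg_abs_le (A z z)
    rw [smul_eq_mul, mul_one]; linarith
  · simpa using hA z w h

/-- A kills constants, so only the zeroth term of the exponential series contributes to a row sum.
-/
theorem Matrix.exp_row_sum (A : Matrix Ω Ω ℝ) (hA : ∀ x, ∑ y, A x y = 0) (x : Ω) :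
    ∑ y, NormedSpace.exp A x y = 1 := by
  have h := hasSum_sum fun y (_ : y ∈ Finset.univ) =>
    (Pi.hasSum.1 (Pi.hasSum.1 (Matrix.hasSum_exp A) x) y)
  refine h.unique ?_
  have h0 : ∀ n : ℕ, n ≠ 0 → ∑ y, (((n ! : ℝ)⁻¹) • A ^ n) x y = 0 := by
    intro n hn
    obtain ⟨m, rfl⟩ := Nat.exists_eq_succ_of_ne_zero hn
    simp only [Matrix.smul_apply, pow_succ, Matrix.mul_apply]
    rw [← Finset.smul_sum, Finset.sum_comm]
    simp only [← Finset.mul_sum, hA, mul_zero, Finset.sum_const_zero, smul_zero]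
  convert hasSum_single 0 h0 using 1
  simp [Matrix.one_apply]

/-- Detailed balance passes to the exponential. -/
theorem Matrix.mul_exp_symm (A : Matrix Ω Ω ℝ) (m : Ω → ℝ)
    (hA : ∀ x y, m x * A x y = m y * A y x) (x y : Ω) :
    m x * NormedSpace.exp A x y = m y * NormedSpace.exp A y x := by
  have hpow : ∀ (n : ℕ) (x y : Ω), m x * (A ^ n) x y = m y * (A ^ n) y x := by
    intro n
    induction n with
    | zero =>
      intro x y
      rw [pow_zero, Matrix.one_apply, Matrix.one_apply]
      by_cases h : x = y
      · subst h; rfl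
      · rw [if_neg h, if_neg (Ne.symm h), mul_zero, mul_zero]
    | succ n ih =>
      intro x y
      rw [pow_succ, Matrix.mul_apply, ← pow_succ, pow_succ', Matrix.mul_apply, Finset.mul_sum,
        Finset.mul_sum]
      refine Finset.sum_congr rfl fun z _ => ?_
      rw [← mul_assoc, ih x z, mul_right_comm, hA z y]; ring
  have h1 := (Pi.hasSum.1 (Pi.hasSum.1 (Matrix.hasSum_exp A) x) y).mul_left (m x)
  have h2 := (Pi.hasSum.1 (Pi.hasSum.1 (Matrix.hasSum_exp A) y) x).mul_left (m y)
  refine h1.unique (h2.congr_fun fun n => ?_)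
  simp only [Matrix.smul_apply, smul_eq_mul]
  rw [mul_left_comm, hpow, mul_left_comm]

theorem exp_smul_nonneg {A : Matrix Ω Ω ℝ} (hA : ∀ x y, x ≠ y → 0 ≤ A x y) (t : ℝ≥0) (x y : Ω) :
    0 ≤ NormedSpace.exp ((t : ℝ) • A) x y :=
  Matrix.exp_nonneg_of_offDiag_nonneg _ (fun x y h => mul_nonneg t.2 (hA x y h)) x y

theorem exp_smul_row_sum {A : Matrix Ω Ω ℝ} (hA0 : ∀ x, ∑ y, A x y = 0) (t : ℝ≥0) (x : Ω) :
    ∑ y, NormedSpace.exp ((t : ℝ) • A) x y = 1 :=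
  Matrix.exp_row_sum _ (fun x => by simp [← Finset.mul_sum, hA0]) x

theorem tendsto_exp_smul_div (A : Matrix Ω Ω ℝ) {x y : Ω} (hxy : x ≠ y) :
    Tendsto (fun t : ℝ≥0 => (t : ℝ)⁻¹ * NormedSpace.exp ((t : ℝ) • A) x y) (𝓝[>] 0)
      (𝓝 (A x y)) := by
  have h := (Matrix.hasDerivAt_exp_smul_zero A x y).tendsto_slope_zero_right
  refine (h.comp tendsto_coe_nhdsGT_zero).congr fun t => ?_
  simp [Matrix.one_apply_ne hxy, NormedSpace.exp_zero]

end FiniteChain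

section MatrixKernel

variable {Ω : Type*} [Fintype Ω] [MeasurableSpace Ω] [MeasurableSingletonClass Ω]

/-- The kernel on a finite space with transition matrix `A`. -/
noncomputable def matrixKernel (A : Matrix Ω Ω ℝ) : Kernel Ω Ω :=
  Kernel.ofFunOfCountable fun x => ∑ y, ENNReal.ofReal (A x y) • Measure.dirac y

theorem matrixKernel_apply (A : Matrix Ω Ω ℝ) (x : Ω) :
    matrixKernel A x = ∑ y, ENNReal.ofReal (A x y) • Measure.dirac y := rfl

theorem lintegral_matrixKernel (A : Matrix Ω Ω ℝ) (f : Ω → ℝ≥0∞) (x : Ω) :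
    ∫⁻ y, f y ∂matrixKernel A x = ∑ y, ENNReal.ofReal (A x y) * f y := by
  rw [matrixKernel_apply, lintegral_finsetSum_measure]
  simp [lintegral_smul_measure]

theorem matrixKernel_apply_set (A : Matrix Ω Ω ℝ) (x : Ω) (s : Set Ω) :
    matrixKernel A x s = ∑ y, ENNReal.ofReal (A x y) * s.indicator 1 y := by
  have hs : MeasurableSet s := s.toFinite.measurableSet
  rw [← lintegral_indicator_one hs, lintegral_matrixKernel]

theorem integral_matrixKernel (A : Matrix Ω Ω ℝ) (hA : ∀ x y, 0 ≤ A x y) (f : Ω → ℝ) (x : Ω) :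
    ∫ y, f y ∂matrixKernel A x = ∑ y, A x y * f y := by
  rw [matrixKernel_apply, integral_finsetSum_measure
    fun y _ => (integrable_dirac (by simp)).smul_measure ENNReal.ofReal_ne_top]
  refine Finset.sum_congr rfl fun y _ => ?_
  rw [integral_smul_measure, integral_dirac, ENNReal.toReal_ofReal (hA x y), smul_eq_mul]

theorem isMarkovKernel_matrixKernel (A : Matrix Ω Ω ℝ) (hA : ∀ x y, 0 ≤ A x y)
    (hA1 : ∀ x, ∑ y, A x y = 1) : IsMarkovKernel (matrixKernel A) := by
  refine ⟨fun x => ⟨?_⟩⟩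
  rw [matrixKernel_apply_set]
  simp only [Set.indicator_univ, Pi.one_apply, mul_one]
  rw [← ENNReal.ofReal_sum_of_nonneg fun y _ => hA x y, hA1, ENNReal.ofReal_one]

theorem matrixKernel_mul (A B : Matrix Ω Ω ℝ) (hA : ∀ x y, 0 ≤ A x y) (hB : ∀ x y, 0 ≤ B x y) :
    matrixKernel (A * B) = matrixKernel B ∘ₖ matrixKernel A := by
  ext x s hs
  rw [Kernel.comp_apply' _ _ _ hs, lintegral_matrixKernel]
  simp only [matrixKernel_apply_set, Finset.mul_sum]
  rw [Finset.sum_comm]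
  refine Finset.sum_congr rfl fun y _ => ?_
  rw [Matrix.mul_apply, ENNReal.ofReal_sum_of_nonneg fun z _ => mul_nonneg (hA x z) (hB z y),
    Finset.sum_mul]
  refine Finset.sum_congr rfl fun z _ => ?_
  rw [ENNReal.ofReal_mul (hA x z), mul_assoc]

theorem matrixKernel_one [DecidableEq Ω] : matrixKernel (1 : Matrix Ω Ω ℝ) = Kernel.id := by
  ext x s hs
  rw [matrixKernel_apply_set, Kernel.id_apply, Measure.dirac_apply' _ hs, Finset.sum_eq_single x]
  · simp
  · intro y _ hy
    simp [Matrix.one_apply_ne (Ne.symm hy)]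
  · simp

theorem isReversible_matrixKernel (A : Matrix Ω Ω ℝ) (μ : Measure Ω) [IsFiniteMeasure μ]
    (hA : ∀ x y, μ.real {x} * A x y = μ.real {y} * A y x) :
    (matrixKernel A).IsReversible μ := by
  intro s t hs ht
  have h : ∀ x y, μ {x} * ENNReal.ofReal (A x y) = μ {y} * ENNReal.ofReal (A y x) := by
    intro x y
    rw [← ofReal_measureReal (s := {x}), ← ofReal_measureReal (s := {y}),
      ← ENNReal.ofReal_mul measureReal_nonneg, ← ENNReal.ofReal_mul measureReal_nonneg, hA]
  rw [← lintegral_indicator hs, ← lintegral_indicator ht, lintegral_fintype, lintegral_fintype]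
  have h1 : ∀ (s t : Set Ω) (x : Ω), s.indicator (fun x => matrixKernel A x t) x * μ {x} =
      ∑ y, s.indicator 1 x * t.indicator 1 y * (μ {x} * ENNReal.ofReal (A x y)) := by
    intro s t x
    by_cases hx : x ∈ s
    · rw [Set.indicator_of_mem hx, matrixKernel_apply_set, Set.indicator_of_mem hx, Finset.sum_mul]
      refine Finset.sum_congr rfl fun y _ => ?_
      rw [Pi.one_apply, one_mul]; ring
    · simp [hx]
  simp only [h1]
  rw [Finset.sum_comm]
  refine Finset.sum_congr rfl fun y _ => Finset.sum_congr rfl fun x _ => ?_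
  rw [h x y]; ring

end MatrixKernel

section Semigroup

variable {Ω : Type*} [Fintype Ω] [DecidableEq Ω] [MeasurableSpace Ω] [MeasurableSingletonClass Ω]

/-- The semigroup on a finite space with generator `A`. -/
noncomputable def expKernel (A : Matrix Ω Ω ℝ) (t : ℝ≥0) : Kernel Ω Ω :=
  matrixKernel (NormedSpace.exp ((t : ℝ) • A))

variable {A : Matrix Ω Ω ℝ} {μ : Measure Ω}

theorem isReversibleMarkovSemigroup_expKernel [IsFiniteMeasure μ]
    (hA : ∀ x y, x ≠ y → 0 ≤ A x y) (hA0 : ∀ x, ∑ y, A x y = 0)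
    (hμ : ∀ x y, μ.real {x} * A x y = μ.real {y} * A y x) :
    IsReversibleMarkovSemigroup μ (expKernel A) where
  markov t := isMarkovKernel_matrixKernel _ (exp_smul_nonneg hA t) (exp_smul_row_sum hA0 t)
  zero := by
    rw [expKernel, NNReal.coe_zero, zero_smul, NormedSpace.exp_zero, matrixKernel_one]
  add s t := by
    rw [expKernel, expKernel, expKernel, ← matrixKernel_mul _ _ (exp_smul_nonneg hA s)
      (exp_smul_nonneg hA t), ← Matrix.exp_add_of_commute, ← add_smul, NNReal.coe_add]
    exact ((Commute.refl A).smul_left _).smul_right _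
  reversible t := isReversible_matrixKernel _ _ fun x y =>
    Matrix.mul_exp_symm _ (fun x => μ.real {x})
      (fun x y => by simp only [Matrix.smul_apply, smul_eq_mul]; linear_combination (t : ℝ) * hμ x y)
      x y
  continuous f _ := by
    set u : ℝ≥0 → ℝ := fun t =>
      ∑ x, ‖(∑ y, NormedSpace.exp ((t : ℝ) • A) x y * f y) - f x‖ with hu
    have hu0 : Tendsto u (𝓝[>] 0) (𝓝 0) := by
      have h1 : ∀ x y, Tendsto (fun t : ℝ≥0 => NormedSpace.exp ((t : ℝ) • A) x y) (𝓝[>] 0)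
          (𝓝 ((1 : Matrix Ω Ω ℝ) x y)) := fun x y => by
        have h := (Matrix.hasDerivAt_exp_smul_zero A x y).continuousAt.tendsto
        rw [zero_smul, NormedSpace.exp_zero] at h
        exact h.comp (tendsto_coe_nhdsGT_zero.mono_right nhdsWithin_le_nhds)
      have h2 : Tendsto u (𝓝[>] 0)
          (𝓝 (∑ x, ‖(∑ y, (1 : Matrix Ω Ω ℝ) x y * f y) - f x‖)) :=
        tendsto_finsetSum _ fun x _ => ((tendsto_finsetSum _ fun y _ =>
          (h1 x y).mul_const (f y)).sub_const (f x)).norm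
      simpa [Matrix.one_apply] using h2
    have h3 : Tendsto (fun t => μ Set.univ ^ (2 : ℝ≥0∞).toReal⁻¹ * ENNReal.ofReal (u t)) (𝓝[>] 0)
        (𝓝 0) := by
      have := ENNReal.Tendsto.const_mul (a := μ Set.univ ^ (2 : ℝ≥0∞).toReal⁻¹)
        (ENNReal.tendsto_ofReal hu0) (Or.inr (by finiteness))
      simpa using this
    refine tendsto_of_tendsto_of_tendsto_of_le_of_le tendsto_const_nhds h3
      (fun _ => zero_le) fun t => ?_
    refine eLpNorm_le_of_ae_bound (Eventually.of_forall fun x => ?_)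
    rw [expKernel, integral_matrixKernel _ (exp_smul_nonneg hA t)]
    exact Finset.single_le_sum
      (f := fun x => ‖(∑ y, NormedSpace.exp ((t : ℝ) • A) x y * f y) - f x‖)
      (fun _ _ => norm_nonneg _) (Finset.mem_univ x)

/-- Diagonal terms vanish identically, and off the diagonal P_t(x, y) / t tends to the generator
entry. -/
theorem semigroupForm_expKernel [IsFiniteMeasure μ]
    (hA : ∀ x y, x ≠ y → 0 ≤ A x y) (f g : Ω → ℝ) :
    semigroupForm μ (expKernel A) f g =
      1 / 2 * ∑ x, ∑ y, μ.real {x} * A x y * ((f x - f y) * (g x - g y)) := by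
  refine Tendsto.limUnder_eq ?_
  have h : ∀ t : ℝ≥0, 1 / (2 * (t : ℝ)) * ∫ x, ∫ y, (f x - f y) * (g x - g y) ∂(expKernel A t x) ∂μ
      = 1 / 2 * ∑ x, ∑ y, μ.real {x} * ((t : ℝ)⁻¹ * NormedSpace.exp ((t : ℝ) • A) x y) *
        ((f x - f y) * (g x - g y)) := by
    intro t
    rw [integral_fintype (Integrable.of_finite)]
    simp only [expKernel, integral_matrixKernel _ (exp_smul_nonneg hA t), smul_eq_mul,
      Finset.mul_sum]
    refine Finset.sum_congr rfl fun x _ => Finset.sum_congr rfl fun y _ => ?_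
    rw [one_div, mul_inv]; ring
  simp only [h]
  refine (tendsto_finsetSum _ fun x _ => tendsto_finsetSum _ fun y _ => ?_).const_mul _
  by_cases hxy : x = y
  · subst hxy; simp
  · exact ((tendsto_exp_smul_div A hxy).const_mul _).mul_const _

theorem semigroupDomain_expKernel [IsFiniteMeasure μ]
    (hA : ∀ x y, x ≠ y → 0 ≤ A x y) (hA0 : ∀ x, ∑ y, A x y = 0) :
    semigroupDomain μ (expKernel A) = Set.univ := by
  refine Set.eq_univ_of_forall fun f => ⟨MemLp.of_discrete, ?_⟩
  -- The supremum runs over all t > 0. The derivative at 0 gives a linear bound for t < δ; for t ≥ δ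
  -- the trivial bound 1 ≤ t / δ is used.
  obtain ⟨M, hM⟩ : ∃ M : ℝ, ∀ (x y : Ω), x ≠ y → ∀ t : ℝ≥0, 0 < t →
      NormedSpace.exp ((t : ℝ) • A) x y ≤ M * t := by
    have h : ∀ x y : Ω, ∃ M : ℝ, 0 ≤ M ∧ (x ≠ y → ∀ t : ℝ≥0, 0 < t →
        NormedSpace.exp ((t : ℝ) • A) x y ≤ M * t) := by
      intro x y
      by_cases hxy : x = y
      · exact ⟨0, le_rfl, fun h => (h hxy).elim⟩
      have h1 : ∀ᶠ t : ℝ≥0 in 𝓝[>] 0,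
          (t : ℝ)⁻¹ * NormedSpace.exp ((t : ℝ) • A) x y < A x y + 1 :=
        (tendsto_exp_smul_div A hxy).eventually (gt_mem_nhds (by linarith))
      obtain ⟨δ, hδ, h2⟩ := (mem_nhdsGT_iff_exists_Ioo_subset).1 h1
      have hδ : (0 : ℝ) < δ := NNReal.coe_pos.2 hδ
      refine ⟨A x y + 1 + (δ : ℝ)⁻¹, by have := hA x y hxy; positivity, fun _ t ht => ?_⟩
      have ht' : (0 : ℝ) < t := NNReal.coe_pos.2 ht
      have hAxy := hA x y hxy
      rcases lt_or_ge t δ with h3 | h3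
      · have h4 : (t : ℝ)⁻¹ * NormedSpace.exp ((t : ℝ) • A) x y < A x y + 1 := h2 ⟨ht, h3⟩
        rw [inv_mul_lt_iff₀ ht'] at h4
        have : 0 < (δ : ℝ)⁻¹ * t := by positivity
        linarith
      · have h3 : (δ : ℝ) ≤ t := NNReal.coe_le_coe.2 h3
        have h4 : NormedSpace.exp ((t : ℝ) • A) x y ≤ 1 := by
          rw [← exp_smul_row_sum hA0 t x]
          exact Finset.single_le_sum (f := fun y => NormedSpace.exp ((t : ℝ) • A) x y)
            (fun y _ => exp_smul_nonneg hA t x y) (Finset.mem_univ y)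
        have h5 : 1 ≤ (δ : ℝ)⁻¹ * t := by rw [← div_eq_inv_mul, one_le_div hδ]; exact h3
        nlinarith
    choose M hM0 hM using h
    refine ⟨∑ x, ∑ y, M x y, fun x y hxy t ht => (hM x y hxy t ht).trans ?_⟩
    refine mul_le_mul_of_nonneg_right ?_ t.2
    exact (Finset.single_le_sum (f := fun y => M x y) (fun y _ => hM0 x y)
      (Finset.mem_univ y)).trans (Finset.single_le_sum (f := fun x => ∑ y, M x y)
        (fun x _ => Finset.sum_nonneg fun y _ => hM0 x y) (Finset.mem_univ x))
  have hbound : (⨆ (t : ℝ≥0) (_ : 0 < t),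
      (∫⁻ x, ∫⁻ y, ENNReal.ofReal ((f x - f y) ^ 2) ∂(expKernel A t x) ∂μ) / (2 * (t : ℝ≥0∞))) ≤
      ∑ x, ∑ y, ENNReal.ofReal M * ENNReal.ofReal ((f x - f y) ^ 2) * μ {x} := by
    refine iSup₂_le fun t ht => ?_
    have ht0 : (t : ℝ≥0∞) ≠ 0 := by simpa using ht.ne'
    refine ENNReal.div_le_of_le_mul ?_
    have h2 : (t : ℝ≥0∞) ≤ 2 * t := by
      rw [two_mul]; exact le_self_add
    refine le_trans ?_ (mul_le_mul_right h2 _)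
    rw [lintegral_fintype, Finset.sum_mul]
    refine Finset.sum_le_sum fun x _ => ?_
    rw [expKernel, lintegral_matrixKernel, Finset.sum_mul, Finset.sum_mul]
    refine Finset.sum_le_sum fun y _ => ?_
    by_cases hxy : x = y
    · subst hxy; simp
    · have h3 : ENNReal.ofReal (NormedSpace.exp ((t : ℝ) • A) x y) ≤ ENNReal.ofReal M * t := by
        have := ENNReal.ofReal_le_ofReal (hM x y hxy t ht)
        rwa [ENNReal.ofReal_mul' t.coe_nonneg, ENNReal.ofReal_coe_nnreal] at this
      calc _ ≤ ENNReal.ofReal M * t * ENNReal.ofReal ((f x - f y) ^ 2) * μ {x} := by gcongr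
        _ = _ := by ring
  refine hbound.trans_lt ?_
  refine ENNReal.sum_lt_top.2 fun x _ => ENNReal.sum_lt_top.2 fun y _ => ?_
  exact ENNReal.mul_lt_top (ENNReal.mul_lt_top ENNReal.ofReal_lt_top ENNReal.ofReal_lt_top)
    (measure_lt_top _ _)

end Semigroup

/-- Symmetric conductances on a finite probability space define a reversible Markov semigroup. -/
theorem exists_semigroup_of_conductance {Ω : Type*} [Fintype Ω] [MeasurableSpace Ω]
    [MeasurableSingletonClass Ω] (μ : Measure Ω) [IsProbabilityMeasure μ]
    (hμ : ∀ x, 0 < μ.real {x}) (J : Ω → Ω → ℝ) (hJ : ∀ x y, 0 ≤ J x y)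
    (hJs : ∀ x y, J x y = J y x) :
    ∃ P : ℝ≥0 → Kernel Ω Ω, IsReversibleMarkovSemigroup μ P ∧ semigroupDomain μ P = Set.univ ∧
      ∀ f g, semigroupForm μ P f g = 1 / 2 * ∑ x, ∑ y, J x y * ((f x - f y) * (g x - g y)) := by
  classical
  -- Rates J / μ give detailed balance from the symmetry of J; the diagonal correction makes the
  -- rows sum to zero.
  set A : Matrix Ω Ω ℝ := Matrix.of fun x y =>
    J x y / μ.real {x} - if x = y then ∑ z, J x z / μ.real {x} else 0 with hA
  have hAne : ∀ x y, x ≠ y → A x y = J x y / μ.real {x} := fun x y h => by simp [hA, h]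
  have hA1 : ∀ x y, x ≠ y → 0 ≤ A x y := fun x y h => by
    rw [hAne x y h]; exact div_nonneg (hJ x y) (hμ x).le
  have hA0 : ∀ x, ∑ y, A x y = 0 := fun x => by simp [hA, Finset.sum_sub_distrib]
  have hmul : ∀ x y, x ≠ y → μ.real {x} * A x y = J x y := fun x y h => by
    rw [hAne x y h, mul_div_cancel₀ _ (hμ x).ne']
  refine ⟨expKernel A, isReversibleMarkovSemigroup_expKernel hA1 hA0 fun x y => ?_,
    semigroupDomain_expKernel hA1 hA0, fun f g => ?_⟩
  · by_cases h : x = y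
    · subst h; rfl
    · rw [hmul x y h, hmul y x (Ne.symm h), hJs]
  · rw [semigroupForm_expKernel hA1]
    congr 1
    refine Finset.sum_congr rfl fun x _ => Finset.sum_congr rfl fun y _ => ?_
    by_cases h : x = y
    · subst h; simp
    · rw [hmul x y h]

/-! ### The chain truncated to {0, …, n}. -/

/-- The mass of the weights `(k!)⁻ᵖ` on `{0, …, n}`. -/
noncomputable def truncMass (p : ℝ) (n : ℕ) : ℝ := ∑ k ∈ Finset.range (n + 1), cmpWeight p k

theorem one_le_truncMass (p : ℝ) (n : ℕ) : 1 ≤ truncMass p n := one_le_sum_cmpWeight p n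

theorem truncWeight_nonneg (p : ℝ) (n : ℕ) (k : ℕ) : 0 ≤ cmpWeight p k / truncMass p n :=
  div_nonneg (cmpWeight_pos p k).le (zero_le_one.trans (one_le_truncMass p n))

/-- The transition matrix all of whose rows are the law conditioned on `{0, …, n}`. -/
noncomputable def truncMatrix (p : ℝ) (n : ℕ) : Matrix (Fin (n + 1)) (Fin (n + 1)) ℝ :=
  Matrix.of fun _ k => cmpWeight p k / truncMass p n

theorem truncMatrix_apply (p : ℝ) (n : ℕ) (j k : Fin (n + 1)) :
    truncMatrix p n j k = cmpWeight p k / truncMass p n := rfl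

theorem truncMatrix_nonneg (p : ℝ) (n : ℕ) (j k : Fin (n + 1)) : 0 ≤ truncMatrix p n j k :=
  truncWeight_nonneg p n k

/-- The Conway–Maxwell–Poisson law conditioned on `{0, …, n}`. -/
noncomputable def truncMeasure (p : ℝ) (n : ℕ) : Measure (Fin (n + 1)) :=
  matrixKernel (truncMatrix p n) 0

theorem isProbabilityMeasure_truncMeasure (p : ℝ) (n : ℕ) :
    IsProbabilityMeasure (truncMeasure p n) := by
  refine (isMarkovKernel_matrixKernel _ (truncMatrix_nonneg p n)
    fun _ => ?_).isProbabilityMeasure 0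
  simp only [truncMatrix_apply]
  rw [← Finset.sum_div, Fin.sum_univ_eq_sum_range (cmpWeight p)]
  have := one_le_truncMass p n
  exact div_self (show truncMass p n ≠ 0 by positivity)

theorem integral_truncMeasure (p : ℝ) (n : ℕ) (f : ℕ → ℝ) :
    ∫ k : Fin (n + 1), f k ∂truncMeasure p n =
      (∑ k ∈ Finset.range (n + 1), cmpWeight p k * f k) / truncMass p n := by
  rw [truncMeasure, integral_matrixKernel _ (truncMatrix_nonneg p n),
    ← Fin.sum_univ_eq_sum_range (fun k => cmpWeight p k * f k), Finset.sum_div]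
  refine Finset.sum_congr rfl fun k _ => ?_
  rw [truncMatrix_apply]; ring

theorem truncMeasure_singleton (p : ℝ) (n : ℕ) (k : Fin (n + 1)) :
    truncMeasure p n {k} = ENNReal.ofReal (cmpWeight p k / truncMass p n) := by
  rw [truncMeasure, matrixKernel_apply_set, Finset.sum_eq_single k]
  · simp [truncMatrix_apply]
  · intro j _ hj; simp [hj]
  · simp

theorem truncMeasure_singleton_pos (p : ℝ) (n : ℕ) (k : Fin (n + 1)) :
    0 < truncMeasure p n {k} := by
  rw [truncMeasure_singleton, ENNReal.ofReal_pos]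
  exact div_pos (cmpWeight_pos p k) (zero_lt_one.trans_le (one_le_truncMass p n))

theorem ent_truncMeasure (p : ℝ) (n : ℕ) (g : ℕ → ℝ) :
    Ent (truncMeasure p n) (fun k => g k) =
      (∑ k ∈ Finset.range (n + 1), cmpWeight p k * (g k * Real.log (g k)) -
        (∑ k ∈ Finset.range (n + 1), cmpWeight p k * g k) *
          Real.log ((∑ k ∈ Finset.range (n + 1), cmpWeight p k * g k) / truncMass p n)) /
        truncMass p n := by
  rw [Ent, integral_truncMeasure p n fun k => g k * Real.log (g k), integral_truncMeasure]; ring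

theorem sum_sum_ite_succ (n : ℕ) (F : ℕ → ℕ → ℝ) :
    ∑ x : Fin (n + 1), ∑ y : Fin (n + 1), (if (y : ℕ) = x + 1 then F x y else 0) =
      ∑ k ∈ Finset.range n, F k (k + 1) := by
  have h : ∀ x : Fin (n + 1), ∑ y : Fin (n + 1), (if (y : ℕ) = x + 1 then F x y else 0) =
      if (x : ℕ) < n then F x (x + 1) else 0 := by
    intro x
    rw [Fin.sum_univ_eq_sum_range (fun y => if y = (x : ℕ) + 1 then F x y else 0) (n + 1),
      Finset.sum_ite_eq']
    simp
  rw [Finset.sum_congr rfl fun x _ => h x,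
    Fin.sum_univ_eq_sum_range (fun x => if x < n then F x (x + 1) else 0) (n + 1),
    Finset.sum_range_succ, if_neg (lt_irrefl n), add_zero]
  exact Finset.sum_congr rfl fun k hk => if_pos (Finset.mem_range.1 hk)

/-- The birth–death chain on `{0, …, n}` reversible for the truncated law. -/
theorem exists_truncSemigroup (p : ℝ) (n : ℕ) :
    ∃ P : ℝ≥0 → Kernel (Fin (n + 1)) (Fin (n + 1)),
      IsReversibleMarkovSemigroup (truncMeasure p n) P ∧
      semigroupDomain (truncMeasure p n) P = Set.univ ∧
      ∀ f g : ℕ → ℝ, semigroupForm (truncMeasure p n) P (fun k => f k) (fun k => g k) =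
        (∑ k ∈ Finset.range n, (f (k + 1) - f k) * (g (k + 1) - g k) * cmpWeight p k) /
          truncMass p n := by
  have := isProbabilityMeasure_truncMeasure p n
  have hnn := truncWeight_nonneg p n
  set J : Fin (n + 1) → Fin (n + 1) → ℝ := fun x y =>
    (if (y : ℕ) = x + 1 then cmpWeight p x / truncMass p n else 0) +
      (if (x : ℕ) = y + 1 then cmpWeight p y / truncMass p n else 0) with hJ
  obtain ⟨P, hP, hdom, hform⟩ := exists_semigroup_of_conductance (truncMeasure p n)
    (fun x => ENNReal.toReal_pos (truncMeasure_singleton_pos p n x).ne' (measure_ne_top _ _)) J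
    (fun x y => by
      have hx := hnn x
      have hy := hnn y
      simp only [hJ]; split_ifs <;> positivity)
    (fun x y => add_comm _ _)
  refine ⟨P, hP, hdom, fun f g => ?_⟩
  rw [hform]
  set F : ℕ → ℕ → ℝ := fun x y =>
    cmpWeight p x / truncMass p n * ((f x - f y) * (g x - g y)) with hF
  have h1 : ∀ x y : Fin (n + 1), J x y * ((f x - f y) * (g x - g y)) =
      (if (y : ℕ) = x + 1 then F x y else 0) + (if (x : ℕ) = y + 1 then F y x else 0) := by
    intro x y
    simp only [hJ, hF, add_mul, ite_mul, zero_mul]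
    congr 1
    split_ifs <;> ring
  simp only [h1, Finset.sum_add_distrib]
  -- Each edge is counted in both orientations, which cancels the factor 1/2 of the form.
  rw [Finset.sum_comm (f := fun x y : Fin (n + 1) => if (x : ℕ) = y + 1 then F y x else 0),
    sum_sum_ite_succ, ← two_mul, ← mul_assoc, one_div_mul_cancel two_ne_zero, one_mul,
    Finset.sum_div]
  refine Finset.sum_congr rfl fun k _ => ?_
  simp only [hF]; ring

/-! ### Failure of the equivalence property. -/

theorem not_MOSEquivalence_of_lt {I : Set ℝ} {p q : ℝ} (hpI : p ∈ I) (hqI : q ∈ I) (hq : 0 < q)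
    (hqp : q < p) (hp1 : p < 1) : ¬ MOSEquivalence I := by
  rintro ⟨c, hc, h⟩
  have hp : 0 < p := hq.trans hqp
  obtain ⟨C, hC, hLS⟩ := sum_entropy_rpow_le hp1 hq hqp
  have hp1' : 0 < 1 - p := by linarith
  set A := c * C * p ^ 2 / (4 * (1 - p)) with hA
  -- The size n is chosen after c and C, which is legitimate because C serves all truncations. There
  -- is no tail beyond n, hence `K := 0`.
  obtain ⟨n, hn⟩ := exists_quadratic_lt_sum_log_factorial hp (A := A) (K := 0) (by positivity) le_rfl
  have := isProbabilityMeasure_truncMeasure p n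
  obtain ⟨P, hP, hdom, hform⟩ := exists_truncSemigroup p n
  have hM1 := one_le_truncMass p n
  have hM : 0 < truncMass p n := by linarith
  have h := h q hqI p hpI (Fin (n + 1)) (truncMeasure p n) P (truncMeasure_singleton_pos p n) hP C hC
  rw [hdom] at h
  simp only [LogSobolevWith, if_neg (show q ≠ 1 by linarith), if_neg (show p ≠ 1 by linarith),
    mem_univ, true_implies] at h
  have hq_LS : ∀ f : Fin (n + 1) → ℝ, (∀ x, 0 < f x) → Ent (truncMeasure p n) (fun x => f x ^ q) ≤
      C * q ^ 2 / (4 * (q - 1)) *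
        semigroupForm (truncMeasure p n) P (fun x => f x ^ (q - 1)) f := by
    intro f hf
    obtain ⟨u, hu, hfu⟩ : ∃ u : ℕ → ℝ, (∀ k, 0 < u k) ∧ f = fun k : Fin (n + 1) => u k :=
      -- Any positive extension to ℕ would do; this one is periodic.
      ⟨fun k => f (Fin.ofNat (n + 1) k), fun k => hf _, by ext k; simp⟩
    subst hfu
    rw [ent_truncMeasure p n fun k => u k ^ q, hform (fun k => u k ^ (q - 1)) u, ← mul_div_assoc]
    exact div_le_div_of_nonneg_right (hLS u n hu) hM.le
  have hfac : ∀ k : ℕ, (0 : ℝ) < (k ! : ℕ) := fun k => by exact_mod_cast k.factorial_pos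
  have h := h hq_LS (fun k => (((k : ℕ)! : ℕ) : ℝ)) fun k => hfac k
  rw [ent_truncMeasure p n fun k => ((k ! : ℕ) : ℝ) ^ p,
    hform (fun k => ((k ! : ℕ) : ℝ) ^ (p - 1)) fun k => ((k ! : ℕ) : ℝ), ← mul_div_assoc,
    div_le_div_iff_of_pos_right hM] at h
  have hE : c * C * p ^ 2 / (4 * (p - 1)) * (∑ k ∈ Finset.range n,
      ((((k + 1)! : ℕ) : ℝ) ^ (p - 1) - ((k ! : ℕ) : ℝ) ^ (p - 1)) *
      ((((k + 1)! : ℕ) : ℝ) - ((k ! : ℕ) : ℝ)) * cmpWeight p k) ≤ A * n ^ 2 := by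
    have e : c * C * p ^ 2 / (4 * (p - 1)) = -A := by
      rw [hA, show 4 * (p - 1) = -(4 * (1 - p)) by ring, div_neg]
    rw [e, neg_mul, ← mul_neg, ← Finset.sum_neg_distrib]
    refine mul_le_mul_of_nonneg_left ?_ (by positivity)
    exact (Finset.sum_le_sum fun k _ => neg_factorial_energy_le p k).trans (sum_range_cast_le_sq n)
  have hlog : ∑ k ∈ Finset.range (n + 1),
      cmpWeight p k * (((k ! : ℕ) : ℝ) ^ p * Real.log (((k ! : ℕ) : ℝ) ^ p)) =
      p * ∑ k ∈ Finset.range (n + 1), Real.log (k ! : ℕ) := by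
    rw [Finset.mul_sum]
    refine Finset.sum_congr rfl fun k _ => ?_
    rw [← mul_assoc, cmpWeight_mul_factorial_rpow, one_mul, Real.log_rpow (hfac k)]
  have hm : ∑ k ∈ Finset.range (n + 1), cmpWeight p k * ((k ! : ℕ) : ℝ) ^ p = n + 1 := by
    simp [cmpWeight_mul_factorial_rpow]
  rw [hlog, hm] at h
  have hm2 := mul_log_div_le_sq (show (0 : ℝ) < n + 1 by positivity) hM1
  rw [add_zero] at hn
  linarith

theorem theoremC :
    (∀ p : ℝ, 0 < p → p < 1 →
      ∃ μ : Measure ℕ, IsProbabilityMeasure μ ∧ (∀ k, 0 < μ {k}) ∧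
        (∀ k, μ.real {k} = ((k ! : ℕ) : ℝ) ^ (-p) / ∑' j : ℕ, ((j ! : ℕ) : ℝ) ^ (-p)) ∧
        ¬ BirthDeathLogSobolev μ p ∧
        ∀ q : ℝ, 0 < q → q < p → BirthDeathLogSobolev μ q) ∧
    (∀ I : Set ℝ, I ⊆ Set.Ioc 0 1 → (interior I).Nonempty → ¬ MOSEquivalence I) := by
  refine ⟨fun p hp hp1 => ⟨cmpMeasure p, isProbabilityMeasure_cmpMeasure hp,
    cmpMeasure_singleton_pos hp, cmpMeasure_real_singleton hp,
    not_birthDeathLogSobolev_cmpMeasure hp hp1,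
    fun q hq hqp => birthDeathLogSobolev_cmpMeasure hp1 hq hqp⟩, fun I hI hne => ?_⟩
  obtain ⟨x, hx⟩ := hne
  obtain ⟨ε, hε, hball⟩ := Metric.mem_nhds_iff.1 (mem_interior_iff_mem_nhds.1 hx)
  have hmem : ∀ y, |y - x| < ε → y ∈ I := fun y hy => hball (by rwa [Metric.mem_ball, Real.dist_eq])
  -- Both exponents are taken to the left of x ≤ 1, so that they are distinct and strictly below 1.
  have hp := hmem (x - ε / 3) (by rw [abs_lt]; constructor <;> linarith)
  have hq := hmem (x - 2 * ε / 3) (by rw [abs_lt]; constructor <;> linarith)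
  have hx1 := (hI (interior_subset hx)).2
  exact not_MOSEquivalence_of_lt hp hq (hI hq).1 (by linarith) (by linarith)
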